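/- Let $n\ge 1$ and let $(\mathcal M,\varphi,\xi,\eta,g)$ be a Riemannian $\Pi$-manifold of dimension $2n+1$, i.e. $\mathcal M$ is a smooth $(2n+1)$-dimensional manifold with a smooth Riemannian metric $g$, a smooth $(1,1)$-tensor field $\varphi$, a smooth vector field $\xi$ and a smooth 1-form $\eta$ such that $$\varphi\xi=0,\quad \varphi^2=I-\eta\otimes\xi,\quad \eta\circ\varphi=0,\quad \eta(\xi)=1,\quad \operatorname{tr}\varphi=0,\quad g(\varphi x,\varphi y)=g(x,y)-\eta(x)\eta(y).$$ Put $\tilde g(x,y)=g(x,\varphi y)+\eta(x)\eta(y)$, let $\nabla$ be the Levi-Civita connection of $g$, and let $\rho(y,z)=\operatorname{tr}\bigl(x\mapsto R(x,y)z\bigr)$ be its Ricci tensor, where $R(x,y)=[\nabla_x,\nabla_y]-\nabla_{[x,y]}$. Assume that the manifold is para-Sasaki-like, i.e. $$(\nabla_x\varphi)y=-g(x,y)\xi-\eta(y)x+2\eta(x)\eta(y)\xi ,$$ and that it admits a para-Ricci-like soliton with real constants $(\lambda,\mu,\nu)$ and potential vector field $v$, i.e. $$\rho=-\tfrac12\mathcal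 L_v g-\lambda g-\mu\tilde g-\nu\,\eta\otimes\eta ,$$ where $v=k\,\xi$ for a differentiable function $k:\mathcal M\to\mathbb R$. Then: (i) $k=-\mu$ everywhere on $\mathcal M$; in particular $k$ is constant; (ii) $\lambda+\nu=k+2n$ on $\mathcal M$; (iii) $\mathcal M$ is $\eta$-Einstein with constants $(a,b,c)=(-\lambda,0,\lambda-2n)$, where being $\eta$-Einstein with constants $(a,b,c)$ means $\rho=a\,g+b\,\tilde g+c\,\eta\otimes\eta$ with $b=0$; that is, $\rho=-\lambda\,g+(\lambda-2n)\,\eta\otimes\eta$. -/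

import Mathlib

open Bundle FiberBundle VectorField
open scoped Manifold ContDiff

noncomputable section

namespace PiManifold

variable {E : Type*} [NormedAddCommGroup E] [NormedSpace ℝ E]
  {H : Type*} [TopologicalSpace H] {I : ModelWithCorners ℝ E H}
  {M : Type*} [TopologicalSpace M] [ChartedSpace H M] [IsManifold I ∞ M]

/-- The right-hand side of the Koszul formula, `2 g(∇_X Y, Z)`. -/
def koszul (g : ContMDiffRiemannianMetric I ∞ E (fun x : M => TangentSpace I x))
    (X Y Z : Π x : M, TangentSpace I x) (x : M) : ℝ :=
  d% (fun y => g.inner y (Y y) (Z y)) x (X x)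
    + d% (fun y => g.inner y (Z y) (X y)) x (Y x)
    - d% (fun y => g.inner y (X y) (Y y)) x (Z x)
    + g.inner x (mlieBracket I X Y x) (Z x)
    - g.inner x (mlieBracket I Y Z x) (X x)
    + g.inner x (mlieBracket I Z X x) (Y x)

variable (g : ContMDiffRiemannianMetric I ∞ E (fun x : M => TangentSpace I x))

theorem mdifferentiableAt_inner {X Y : Π x : M, TangentSpace I x} {x : M}
    (hX : MDiffAt (T% X) x) (hY : MDiffAt (T% Y) x) :
    MDiffAt (fun y => g.inner y (X y) (Y y)) x := by
  have h := MDifferentiableAt.clm_bundle_apply₂ (F₁ := E) (F₂ := E) (F₃ := ℝ)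
    (E₃ := Bundle.Trivial M ℝ)
    ((g.contMDiff x).mdifferentiableAt (by simp)) hX hY
  rw [mdifferentiableAt_totalSpace] at h
  exact h.2

theorem leviCivitaFun_ext {x : M} {A B : TangentSpace I x →L[ℝ] TangentSpace I x}
    (h : ∀ u w : TangentSpace I x, g.inner x (A u) w = g.inner x (B u) w) : A = B := by
  ext u
  by_contra hne
  have := g.pos x (A u - B u) (sub_ne_zero.mpr hne)
  simp [map_sub, h] at this

variable [FiniteDimensional ℝ E]

theorem koszul_tensorial_right {X Y : Π x : M, TangentSpace I x} {x : M}
    (hX : MDiffAt (T% X) x) (hY : MDiffAt (T% Y) x) :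
    TensorialAt I E (koszul g X Y · x) x where
  smul {f Z} hf hZ := by
    have e1 : d% (fun y => g.inner y (Y y) ((f • Z) y)) x
        = d% (fun y => f y * g.inner y (Y y) (Z y)) x := by
      congr 1; ext y; simp
    have e2 : d% (fun y => g.inner y ((f • Z) y) (X y)) x
        = d% (fun y => f y * g.inner y (Z y) (X y)) x := by
      congr 1; ext y; simp
    simp only [koszul, e1, e2, mvfderiv_fun_mul hf (mdifferentiableAt_inner g hY hZ),
      mvfderiv_fun_mul hf (mdifferentiableAt_inner g hZ hX),
      mlieBracket_smul_left hf hZ, mlieBracket_smul_right hf hZ]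
    simp [g.symm x (Z x) (Y x)]
    ring
  add {Z Z'} hZ hZ' := by
    have e1 : d% (fun y => g.inner y (Y y) ((Z + Z') y)) x
        = d% (fun y => g.inner y (Y y) (Z y) + g.inner y (Y y) (Z' y)) x := by
      congr 1; ext y; simp
    have e2 : d% (fun y => g.inner y ((Z + Z') y) (X y)) x
        = d% (fun y => g.inner y (Z y) (X y) + g.inner y (Z' y) (X y)) x := by
      congr 1; ext y; simp
    simp only [koszul, e1, e2,
      mvfderiv_fun_add (mdifferentiableAt_inner g hY hZ) (mdifferentiableAt_inner g hY hZ'),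
      mvfderiv_fun_add (mdifferentiableAt_inner g hZ hX) (mdifferentiableAt_inner g hZ' hX),
      mlieBracket_add_left hZ hZ', mlieBracket_add_right hZ hZ']
    simp
    ring

theorem koszul_tensorial_left {Y Z : Π x : M, TangentSpace I x} {x : M}
    (hY : MDiffAt (T% Y) x) (hZ : MDiffAt (T% Z) x) :
    TensorialAt I E (koszul g · Y Z x) x where
  smul {f X} hf hX := by
    have e1 : d% (fun y => g.inner y (Z y) ((f • X) y)) x
        = d% (fun y => f y * g.inner y (Z y) (X y)) x := by
      congr 1; ext y; simp
    have e2 : d% (fun y => g.inner y ((f • X) y) (Y y)) x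
        = d% (fun y => f y * g.inner y (X y) (Y y)) x := by
      congr 1; ext y; simp
    simp only [koszul, e1, e2, mvfderiv_fun_mul hf (mdifferentiableAt_inner g hX hY),
      mvfderiv_fun_mul hf (mdifferentiableAt_inner g hZ hX),
      mlieBracket_smul_left hf hX, mlieBracket_smul_right hf hX]
    simp [g.symm x (Z x) (X x)]
    ring
  add {X X'} hX hX' := by
    have e1 : d% (fun y => g.inner y (Z y) ((X + X') y)) x
        = d% (fun y => g.inner y (Z y) (X y) + g.inner y (Z y) (X' y)) x := by
      congr 1; ext y; simp
    have e2 : d% (fun y => g.inner y ((X + X') y) (Y y)) x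
        = d% (fun y => g.inner y (X y) (Y y) + g.inner y (X' y) (Y y)) x := by
      congr 1; ext y; simp
    simp only [koszul, e1, e2,
      mvfderiv_fun_add (mdifferentiableAt_inner g hZ hX) (mdifferentiableAt_inner g hZ hX'),
      mvfderiv_fun_add (mdifferentiableAt_inner g hX hY) (mdifferentiableAt_inner g hX' hY),
      mlieBracket_add_left hX hX', mlieBracket_add_right hX hX']
    simp
    ring

theorem koszul_add_middle {X Y Y' Z : Π x : M, TangentSpace I x} {x : M}
    (hX : MDiffAt (T% X) x) (hY : MDiffAt (T% Y) x) (hY' : MDiffAt (T% Y') x)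
    (hZ : MDiffAt (T% Z) x) :
    koszul g X (Y + Y') Z x = koszul g X Y Z x + koszul g X Y' Z x := by
  have e1 : d% (fun y => g.inner y ((Y + Y') y) (Z y)) x
      = d% (fun y => g.inner y (Y y) (Z y) + g.inner y (Y' y) (Z y)) x := by
    congr 1; ext y; simp
  have e2 : d% (fun y => g.inner y (X y) ((Y + Y') y)) x
      = d% (fun y => g.inner y (X y) (Y y) + g.inner y (X y) (Y' y)) x := by
    congr 1; ext y; simp
  simp only [koszul, e1, e2,
    mvfderiv_fun_add (mdifferentiableAt_inner g hY hZ) (mdifferentiableAt_inner g hY' hZ),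
    mvfderiv_fun_add (mdifferentiableAt_inner g hX hY) (mdifferentiableAt_inner g hX hY'),
    mlieBracket_add_left hY hY', mlieBracket_add_right hY hY']
  simp
  ring

theorem koszul_smul_middle {X Y Z : Π x : M, TangentSpace I x} {f : M → ℝ} {x : M}
    (hX : MDiffAt (T% X) x) (hY : MDiffAt (T% Y) x) (hZ : MDiffAt (T% Z) x) (hf : MDiffAt f x) :
    koszul g X (f • Y) Z x =
      f x * koszul g X Y Z x + 2 * (d% f x (X x) * g.inner x (Y x) (Z x)) := by
  have e1 : d% (fun y => g.inner y ((f • Y) y) (Z y)) x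
      = d% (fun y => f y * g.inner y (Y y) (Z y)) x := by
    congr 1; ext y; simp
  have e2 : d% (fun y => g.inner y (X y) ((f • Y) y)) x
      = d% (fun y => f y * g.inner y (X y) (Y y)) x := by
    congr 1; ext y; simp
  simp only [koszul, e1, e2, mvfderiv_fun_mul hf (mdifferentiableAt_inner g hX hY),
    mvfderiv_fun_mul hf (mdifferentiableAt_inner g hY hZ),
    mlieBracket_smul_left hf hY, mlieBracket_smul_right hf hY]
  simp [g.symm x (X x) (Y x)]
  ring

theorem inner_isInvertible (x : M) : (g.inner x).IsInvertible := by
  have : FiniteDimensional ℝ (TangentSpace I x) := inferInstanceAs (FiniteDimensional ℝ E)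
  have : T2Space (TangentSpace I x) := inferInstanceAs (T2Space E)
  have hinj : Function.Injective (g.inner x).toLinearMap := by
    rw [injective_iff_map_eq_zero]
    intro v hv
    by_contra hne
    have := g.pos x v hne
    have h0 : g.inner x v = 0 := hv
    simp [h0] at this
  have : FiniteDimensional ℝ (TangentSpace I x →L[ℝ] ℝ) :=
    inferInstanceAs (FiniteDimensional ℝ (E →L[ℝ] ℝ))
  have hdim : Module.finrank ℝ (TangentSpace I x) =
      Module.finrank ℝ (TangentSpace I x →L[ℝ] ℝ) := by
    rw [← (LinearMap.toContinuousLinearMap (𝕜 := ℝ) (E := TangentSpace I x)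
      (F' := ℝ)).finrank_eq]
    exact (Subspace.dual_finrank_eq).symm
  let e :=
    (LinearEquiv.ofInjectiveOfFinrankEq (g.inner x).toLinearMap hinj hdim).toContinuousLinearEquiv
  exact ⟨e, by ext; rfl⟩

open scoped Classical in
/-- `leviCivitaFun g Y x u` is `∇_u Y` at `x`. At a point where the field `Y` is differentiable it is
given by the Koszul formula `g(∇_X Y, Z) = koszul X Y Z / 2`, where `(g.inner x).inverse` raises the
index; where `Y` is not differentiable it takes the (irrelevant) value `0`. -/
def leviCivitaFun (Y : Π x : M, TangentSpace I x) (x : M) :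
    TangentSpace I x →L[ℝ] TangentSpace I x :=
  if hY : MDiffAt (T% Y) x then
    (g.inner x).inverse ∘L ((1 / 2 : ℝ) • TensorialAt.mkHom₂ (koszul g · Y · x) x
      (fun _ hZ => koszul_tensorial_left g hY hZ) (fun _ hX => koszul_tensorial_right g hX hY))
  else 0

theorem inner_leviCivitaFun {X Y Z : Π x : M, TangentSpace I x} {x : M}
    (hX : MDiffAt (T% X) x) (hY : MDiffAt (T% Y) x) (hZ : MDiffAt (T% Z) x) :
    g.inner x (leviCivitaFun g Y x (X x)) (Z x) = (1 / 2) * koszul g X Y Z x := by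
  have hinv : ∀ α, g.inner x ((g.inner x).inverse α) = α := by
    obtain ⟨e, he⟩ := inner_isInvertible g x
    intro α
    rw [← he]
    simp
  simp only [leviCivitaFun, hY, dite_true, ContinuousLinearMap.comp_apply, hinv]
  simp only [smul_apply, smul_eq_mul]
  rw [TensorialAt.mkHom₂_apply _ _ hX hZ]

/-- The Levi-Civita connection of the Riemannian metric `g`; `leviCivita g Y x u` is `∇_u Y` at `x`.
The two theorems that follow show that it is metric and torsion-free. -/
def leviCivita : CovariantDerivative I E (fun x : M => TangentSpace I x) where
  toFun := leviCivitaFun g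
  isCovariantDerivativeOnUniv :=
    { add := by
        intro Y Y' x hY hY' _
        refine leviCivitaFun_ext g fun u w => ?_
        have hu := mdifferentiableAt_extend I E u
        have hw := mdifferentiableAt_extend I E w
        have h1 := inner_leviCivitaFun g hu hY hw
        have h2 := inner_leviCivitaFun g hu hY' hw
        have h3 := inner_leviCivitaFun g hu (mdifferentiableAt_add_section hY hY') hw
        have h4 := koszul_add_middle g hu hY hY' hw
        simp only [extend_apply_self] at h1 h2 h3
        simp only [add_apply, map_add, h1, h2]
        erw [h3, h4]
        ring
      leibniz := by
        intro Y f x hY hf _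
        refine leviCivitaFun_ext g fun u w => ?_
        have hu := mdifferentiableAt_extend I E u
        have hw := mdifferentiableAt_extend I E w
        have h1 := inner_leviCivitaFun g hu hY hw
        have h3 := inner_leviCivitaFun g hu (hf.smul_section hY) hw
        have h4 := koszul_smul_middle g hu hY hw hf
        simp only [extend_apply_self] at h1 h3 h4
        erw [h3, h4]
        simp [h1]
        ring }

theorem leviCivita_metric {X Y Z : Π x : M, TangentSpace I x} {x : M}
    (hX : MDiffAt (T% X) x) (hY : MDiffAt (T% Y) x) (hZ : MDiffAt (T% Z) x) :
    d% (fun y => g.inner y (Y y) (Z y)) x (X x) =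
      g.inner x (leviCivita g Y x (X x)) (Z x) + g.inner x (Y x) (leviCivita g Z x (X x)) := by
  have h1 := inner_leviCivitaFun g hX hY hZ
  have h2 := inner_leviCivitaFun g hX hZ hY
  have e1 : (fun y => g.inner y (Z y) (Y y)) = fun y => g.inner y (Y y) (Z y) :=
    funext fun y => g.symm y _ _
  have e2 : (fun y => g.inner y (Y y) (X y)) = fun y => g.inner y (X y) (Y y) :=
    funext fun y => g.symm y _ _
  have e3 : (fun y => g.inner y (Z y) (X y)) = fun y => g.inner y (X y) (Z y) :=
    funext fun y => g.symm y _ _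
  change _ = g.inner x (leviCivitaFun g Y x (X x)) (Z x)
    + g.inner x (Y x) (leviCivitaFun g Z x (X x))
  rw [g.symm x (Y x), h1, h2]
  simp only [koszul, e1, e2, e3, mlieBracket_swap_apply (V := Z) (W := Y),
    mlieBracket_swap_apply (V := Z) (W := X), mlieBracket_swap_apply (V := Y) (W := X), map_neg,
    neg_apply]
  ring

theorem leviCivita_torsion_free {X Y : Π x : M, TangentSpace I x} {x : M}
    (hX : MDiffAt (T% X) x) (hY : MDiffAt (T% Y) x) :
    leviCivita g Y x (X x) - leviCivita g X x (Y x) = mlieBracket I X Y x := by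
  have key : ∀ w : TangentSpace I x, g.inner x
      (leviCivitaFun g Y x (X x) - leviCivitaFun g X x (Y x) - mlieBracket I X Y x) w = 0 := by
    intro w
    have hw := mdifferentiableAt_extend I E w
    have h1 := inner_leviCivitaFun g hX hY hw
    have h2 := inner_leviCivitaFun g hY hX hw
    have e (A B : Π x : M, TangentSpace I x) :
        (fun y => g.inner y (A y) (B y)) = fun y => g.inner y (B y) (A y) :=
      funext fun y => g.symm y _ _
    rw [extend_apply_self] at h1 h2
    simp only [map_sub, sub_apply, h1, h2]
    simp only [koszul, e _ X, e Y (extend E w), mlieBracket_swap_apply (V := extend E w) (W := Y),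
      mlieBracket_swap_apply (V := extend E w) (W := X),
      mlieBracket_swap_apply (V := Y) (W := X), map_neg, neg_apply, extend_apply_self]
    ring
  by_contra hne
  have h := g.pos x _ (sub_ne_zero.mpr hne)
  exact h.ne' (key _)

/-- The curvature `R(X, Y)Z = ∇_X ∇_Y Z - ∇_Y ∇_X Z - ∇_[X,Y] Z`. -/
def curvature (X Y Z : Π x : M, TangentSpace I x) (x : M) : TangentSpace I x :=
  leviCivita g (fun y => leviCivita g Z y (Y y)) x (X x)
    - leviCivita g (fun y => leviCivita g Z y (X y)) x (Y x)
    - leviCivita g Z x (mlieBracket I X Y x)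

instance tangentSpace_finiteDimensional (x : M) : FiniteDimensional ℝ (TangentSpace I x) :=
  inferInstanceAs (FiniteDimensional ℝ E)

/-- The Ricci tensor `ρ(u, w) = trace (e ↦ R(e, u)w)` at the point `x`. The trace is computed in a
basis of the tangent space; tangent vectors are extended to vector fields that are smooth near `x`,
and the value does not depend on the extensions, since `R` is tensorial. -/
def ricci (x : M) (u w : TangentSpace I x) : ℝ :=
  ∑ i, (Module.finBasis ℝ (TangentSpace I x)).coord i
    (curvature g (extend E (Module.finBasis ℝ (TangentSpace I x) i)) (extend E u) (extend E w) x)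

/-- The Lie derivative of the metric, `(L_v g)(X, Y) = v(g(X, Y)) - g([v, X], Y) - g(X, [v, Y])`,
at tangent vectors `u, w` at `x`, extended to vector fields that are smooth near `x` (the value
does not depend on the extensions). -/
def lieDerivMetric (v : Π x : M, TangentSpace I x) (x : M) (u w : TangentSpace I x) : ℝ :=
  d% (fun y => g.inner y (extend E u y) (extend E w y)) x (v x)
    - g.inner x (mlieBracket I v (extend E u) x) w
    - g.inner x u (mlieBracket I v (extend E w) x)

variable (I M) in
/-- A Riemannian `Π`-structure `(φ, ξ, η, g)` on `M`: an almost paracontact almost paracomplex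
structure with a compatible Riemannian metric. -/
structure RiemannianPiStructure where
  /-- the Riemannian metric -/
  g : ContMDiffRiemannianMetric I ∞ E (fun x : M => TangentSpace I x)
  /-- the (1,1)-tensor field -/
  φ : Π x : M, TangentSpace I x →L[ℝ] TangentSpace I x
  /-- the Reeb vector field -/
  ξ : Π x : M, TangentSpace I x
  /-- the dual 1-form -/
  η : Π x : M, TangentSpace I x →L[ℝ] ℝ
  φ_smooth : ContMDiff I (I.prod 𝓘(ℝ, E →L[ℝ] E)) ∞ (fun x => TotalSpace.mk' (E →L[ℝ] E)
    (E := fun x : M => TangentSpace I x →L[ℝ] TangentSpace I x) x (φ x))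
  ξ_smooth : CMDiff ∞ (T% ξ)
  η_smooth : ContMDiff I (I.prod 𝓘(ℝ, E →L[ℝ] ℝ)) ∞ (fun x => TotalSpace.mk' (E →L[ℝ] ℝ)
    (E := fun x : M => TangentSpace I x →L[ℝ] ℝ) x (η x))
  φ_ξ : ∀ x, φ x (ξ x) = 0
  φ_sq : ∀ x u, φ x (φ x u) = u - η x u • ξ x
  η_φ : ∀ x u, η x (φ x u) = 0
  η_ξ : ∀ x, η x (ξ x) = 1
  trace_φ : ∀ x, LinearMap.trace ℝ (TangentSpace I x) (φ x).toLinearMap = 0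
  compat : ∀ x u w, g.inner x (φ x u) (φ x w) = g.inner x u w - η x u * η x w

namespace RiemannianPiStructure

variable (S : RiemannianPiStructure I M)

/-- The associated metric `g̃(u, w) = g(u, φw) + η(u)η(w)`. -/
def assocMetric (x : M) (u w : TangentSpace I x) : ℝ :=
  S.g.inner x u (S.φ x w) + S.η x u * S.η x w

/-- The covariant derivative `(∇_u φ)w = ∇_u (φW) - φ(∇_u W)` at `x`, where `W` extends `w` to a
vector field that is smooth near `x` (the value does not depend on the extension). -/
def nablaPhi (x : M) (u w : TangentSpace I x) : TangentSpace I x :=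
  leviCivita S.g (fun y => S.φ y (extend E w y)) x u - S.φ x (leviCivita S.g (extend E w) x u)

/-- Para-Sasaki-like: `(∇_u φ)w = -g(u, w)ξ - η(w)u + 2η(u)η(w)ξ`. -/
def IsParaSasakiLike : Prop :=
  ∀ (x : M) (u w : TangentSpace I x), S.nablaPhi x u w =
    -(S.g.inner x u w • S.ξ x) - S.η x w • u + (2 * S.η x u * S.η x w) • S.ξ x

/-- The manifold admits a para-Ricci-like soliton with potential `v` and constants
`(lam, mu, nu)`: `ρ = -(1/2) L_v g - lam g - mu g̃ - nu η ⊗ η`. -/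
def IsParaRicciLikeSoliton (v : Π x : M, TangentSpace I x) (lam mu nu : ℝ) : Prop :=
  ∀ (x : M) (u w : TangentSpace I x), ricci S.g x u w =
    -(1 / 2) * lieDerivMetric S.g v x u w - lam * S.g.inner x u w
      - mu * S.assocMetric x u w - nu * (S.η x u * S.η x w)

/-- Para-Einstein-like with constants `(a, b, c)`: `ρ = a g + b g̃ + c η ⊗ η`. -/
def IsParaEinsteinLike (a b c : ℝ) : Prop :=
  ∀ (x : M) (u w : TangentSpace I x), ricci S.g x u w =
    a * S.g.inner x u w + b * S.assocMetric x u w + c * (S.η x u * S.η x w)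

/-- `η`-Einstein with constants `(a, b, c)`: para-Einstein-like with `b = 0`. -/
def IsEtaEinstein (a b c : ℝ) : Prop :=
  b = 0 ∧ S.IsParaEinsteinLike a b c

end RiemannianPiStructure

end PiManifold

end

/-! The para-Sasaki-like condition gives `∇_X ξ = φX`. Differentiating once more gives `R(X,Y)ξ =
η(X)Y - η(Y)X`, whose trace is `ρ(·,ξ) = (1 - m)η`, where `m = 2n+1` is the dimension. Since `φ` is
symmetric, `L_{kξ} g = 2k g(·,φ·) + dk⊗η + η⊗dk`. Putting `ξ` into the soliton equation therefore
forces `dk = (m - 1 - λ - μ - ν)η`, and the equation becomes `ρ = -(k+μ) g(·,φ·) - λg + (λ+1-m)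
η⊗η`.

It remains to show that `k = -μ`, and this needs information beyond the values `ρ(·,ξ)`. The second
Bianchi identity with one argument `ξ` expresses `∇_ξ R` algebraically through `R`, `φ` and `g`,
because every curvature term containing `ξ` is explicit. Taking the trace, and using the commutator
of `R` with `φ` to contract `R(φ·,Y)Z`, yields `(∇_ξ ρ)(Y,Z) = -ρ(φY,Z) - ρ(Y,φZ)`, that is, `L_ξ ρ
= 0` (`mvfderiv_ricci_ξ`).

Along `ξ` both `φ` and `η` are parallel, so substituting the reduced form of `ρ` produces a linear
relation between `φ` and `I - η⊗ξ`, with `k + μ` as coefficient of the latter up to a factor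
(`φ_relation_of_soliton`). Its trace kills `φ` and leaves `(k+μ)(m-1) = 0`. Hence `k` is the
constant `-μ`; then `dk(ξ) = 0` gives the relation between the constants, and the reduced form of
`ρ` is `η`-Einstein.

Before that, the curvature must be shown to be tensorial and to have its classical symmetries. This
is done for vector fields smooth near a point, which suffices since the extensions of tangent
vectors are of this kind. -/

open Filter
open scoped Topology

noncomputable section

namespace PiManifold

/-! ### Functions and vector fields that are smooth near a point. -/

section SmoothNear

variable {E : Type*} [NormedAddCommGroup E] [NormedSpace ℝ E]
  {H : Type*} [TopologicalSpace H] {I : ModelWithCorners ℝ E H}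
  {M : Type*} [TopologicalSpace M] [ChartedSpace H M]

variable (I) in
/-- The function `f` is smooth on a neighbourhood of `x`. -/
def SmoothFunNear (f : M → ℝ) (x : M) : Prop :=
  ∀ᶠ y in 𝓝 x, CMDiffAt ∞ f y

variable {f f' : M → ℝ} {x : M}

theorem SmoothFunNear.contMDiffAt (h : SmoothFunNear I f x) : CMDiffAt ∞ f x := h.self_of_nhds

theorem SmoothFunNear.mdifferentiableAt (h : SmoothFunNear I f x) : MDiffAt f x :=
  h.contMDiffAt.mdifferentiableAt (by simp)

theorem SmoothFunNear.eventually (h : SmoothFunNear I f x) : ∀ᶠ y in 𝓝 x, SmoothFunNear I f y :=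
  h.eventually_nhds

theorem SmoothFunNear.congr (h : SmoothFunNear I f x) (e : ∀ᶠ y in 𝓝 x, f' y = f y) :
    SmoothFunNear I f' x := by
  filter_upwards [h, e.eventually_nhds] with y hy ey
  exact hy.congr_of_eventuallyEq ey

theorem SmoothFunNear.const (c : ℝ) : SmoothFunNear I (fun _ : M => c) x :=
  .of_forall fun _ => contMDiffAt_const

theorem SmoothFunNear.add (h : SmoothFunNear I f x) (h' : SmoothFunNear I f' x) :
    SmoothFunNear I (fun y => f y + f' y) x := by
  filter_upwards [h, h'] with y h1 h2
  exact h1.add h2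

theorem SmoothFunNear.sub (h : SmoothFunNear I f x) (h' : SmoothFunNear I f' x) :
    SmoothFunNear I (fun y => f y - f' y) x := by
  filter_upwards [h, h'] with y h1 h2
  exact h1.sub h2

theorem SmoothFunNear.mul (h : SmoothFunNear I f x) (h' : SmoothFunNear I f' x) :
    SmoothFunNear I (fun y => f y * f' y) x := by
  filter_upwards [h, h'] with y h1 h2
  exact h1.mul h2

variable [IsManifold I ∞ M]

/-- The vector field `X` is smooth on a neighbourhood of `x`. -/
def SmoothNear (X : Π x : M, TangentSpace I x) (x : M) : Prop :=
  ∀ᶠ y in 𝓝 x, CMDiffAt ∞ (T% X) y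

variable {X Y Z : Π x : M, TangentSpace I x}

theorem SmoothNear.contMDiffAt (h : SmoothNear X x) : CMDiffAt ∞ (T% X) x := h.self_of_nhds

theorem SmoothNear.mdifferentiableAt (h : SmoothNear X x) : MDiffAt (T% X) x :=
  h.contMDiffAt.mdifferentiableAt (by simp)

theorem SmoothNear.eventually (h : SmoothNear X x) : ∀ᶠ y in 𝓝 x, SmoothNear X y :=
  h.eventually_nhds

theorem SmoothNear.congr (h : SmoothNear X x) (e : ∀ᶠ y in 𝓝 x, Y y = X y) : SmoothNear Y x := by
  filter_upwards [h, e.eventually_nhds] with y hy ey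
  exact hy.congr_of_eventuallyEq (ey.mono fun z hz => by simp [hz])

theorem SmoothNear.add (hX : SmoothNear X x) (hY : SmoothNear Y x) : SmoothNear (X + Y) x := by
  filter_upwards [hX, hY] with y h1 h2
  exact h1.add_section h2

theorem SmoothNear.sub (hX : SmoothNear X x) (hY : SmoothNear Y x) : SmoothNear (X - Y) x := by
  filter_upwards [hX, hY] with y h1 h2
  exact h1.sub_section h2

theorem SmoothNear.neg (hX : SmoothNear X x) : SmoothNear (-X) x := by
  filter_upwards [hX] with y h1
  exact h1.neg_section

theorem SmoothNear.smul (hf : SmoothFunNear I f x) (hX : SmoothNear X x) :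
    SmoothNear (f • X) x := by
  filter_upwards [hf, hX] with y h1 h2
  exact h1.smul_section h2

theorem SmoothNear.sum {ι : Type*} {s : Finset ι} {X : ι → Π x : M, TangentSpace I x}
    (hX : ∀ i ∈ s, SmoothNear (X i) x) : SmoothNear (fun y => ∑ i ∈ s, X i y) x := by
  have : ∀ᶠ y in 𝓝 x, ∀ i ∈ s, CMDiffAt ∞ (T% (X i)) y := (s.eventually_all).2 hX
  filter_upwards [this] with y hy
  exact .sum_section hy

theorem smoothNear_extend (u : TangentSpace I x) : SmoothNear (extend E u) x := by
  obtain ⟨s, hs, h⟩ := exists_contMDiffOn_extend (k := ∞) I E u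
  filter_upwards [eventually_mem_nhds_iff.2 hs] with y hy
  exact h.contMDiffAt hy

theorem SmoothNear.inner (g : ContMDiffRiemannianMetric I ∞ E (fun x : M => TangentSpace I x))
    (hX : SmoothNear X x) (hY : SmoothNear Y x) :
    SmoothFunNear I (fun y => g.inner y (X y) (Y y)) x := by
  filter_upwards [hX, hY] with y h1 h2
  have h := ContMDiffAt.clm_bundle_apply₂ (F₁ := E) (F₂ := E) (F₃ := ℝ)
    (E₃ := Bundle.Trivial M ℝ) (g.contMDiff y) h1 h2
  rw [contMDiffAt_totalSpace] at h
  exact h.2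

theorem SmoothFunNear.deriv (hf : SmoothFunNear I f x) (hX : SmoothNear X x) :
    SmoothFunNear I (fun y => d% f y (X y)) x := by
  filter_upwards [hf, hX] with y h1 h2
  have h := ContMDiffAt.clm_apply_of_inCoordinates (h1.mfderiv_const (m := ∞) (by simp)) h2 h1
  rw [contMDiffAt_totalSpace] at h
  have h3 := h.2
  simp at h3
  exact h3

variable [FiniteDimensional ℝ E]

theorem SmoothNear.mlieBracket (hX : SmoothNear X x) (hY : SmoothNear Y x) :
    SmoothNear (mlieBracket I X Y) x := by
  have : IsManifold I (minSmoothness ℝ 2) M := by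
    rw [minSmoothness_of_isRCLikeNormedField]; infer_instance
  have : IsManifold I (∞ + 1) M := inferInstanceAs (IsManifold I ∞ M)
  filter_upwards [hX, hY] with y h1 h2
  exact ContMDiffAt.mlieBracket_vectorField (m := ⊤) (n := ⊤) h1 h2 (by simp)

theorem mlieBracket_jacobi (hX : SmoothNear X x) (hY : SmoothNear Y x) (hZ : SmoothNear Z x) :
    VectorField.mlieBracket I X (VectorField.mlieBracket I Y Z) x =
      VectorField.mlieBracket I (VectorField.mlieBracket I X Y) Z x +
        VectorField.mlieBracket I Y (VectorField.mlieBracket I X Z) x := by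
  have : IsManifold I (minSmoothness ℝ 3) M := by
    rw [minSmoothness_of_isRCLikeNormedField]; infer_instance
  have h : minSmoothness ℝ 2 ≤ (∞ : ℕ∞ω) := by
    rw [minSmoothness_of_isRCLikeNormedField]
    exact WithTop.coe_le_coe.2 (le_top : (2 : ℕ∞) ≤ ⊤)
  exact leibniz_identity_mlieBracket_apply (hX.contMDiffAt.of_le h)
    (hY.contMDiffAt.of_le h) (hZ.contMDiffAt.of_le h)

end SmoothNear

theorem mvfderiv_congr {E : Type*} [NormedAddCommGroup E] [NormedSpace ℝ E]
    {H : Type*} [TopologicalSpace H] {I : ModelWithCorners ℝ E H}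
    {M : Type*} [TopologicalSpace M] [ChartedSpace H M] {f f' : M → ℝ} {x : M}
    (h : ∀ᶠ y in 𝓝 x, f' y = f y) : d% f' x = d% f x := by
  have h' : f' =ᶠ[𝓝 x] f := h
  ext u
  simp only [mvfderiv, ContinuousLinearMap.comp_apply, h'.mfderiv_eq]
  rfl

/-! ### Local frames and the Levi-Civita connection on smooth fields. -/

section Connection

variable {E : Type*} [NormedAddCommGroup E] [NormedSpace ℝ E]
  {H : Type*} [TopologicalSpace H] {I : ModelWithCorners ℝ E H}
  {M : Type*} [TopologicalSpace M] [ChartedSpace H M] [IsManifold I ∞ M]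
  {g : ContMDiffRiemannianMetric I ∞ E (fun x : M => TangentSpace I x)}
  {X X' Y Y' Z W : Π x : M, TangentSpace I x} {f : M → ℝ} {x : M}

/-- If the inner products of a vector field with the members of a smooth frame are smooth, then so
are its coefficients in the frame. -/
theorem exists_smooth_coeff_of_inner {ι : Type*} [Fintype ι] {s : ι → Π y : M, TangentSpace I y}
    (hs : ∀ i, SmoothNear (s i) x)
    (hb : ∀ᶠ y in 𝓝 x, ∃ b : Module.Basis ι ℝ (TangentSpace I y), ∀ i, b i = s i y)
    {V : Π x : M, TangentSpace I x}
    (h : ∀ i, SmoothFunNear I (fun y => g.inner y (V y) (s i y)) x) :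
    ∃ c : ι → M → ℝ, (∀ i, SmoothFunNear I (c i) x) ∧ ∀ᶠ y in 𝓝 x, V y = ∑ i, c i y • s i y := by
  classical
  let L (i j : ι) : (ι → ℝ) →L[ℝ] (ι → ℝ) :=
    (ContinuousLinearMap.proj (R := ℝ) (φ := fun _ : ι => ℝ) i).smulRight (Pi.single j (1 : ℝ))
  -- The Gram matrix of the frame, as an operator on coefficient vectors. The coefficients of `V`
  -- are its inverse applied to the vector `β` of inner products.
  let Φ (y : M) : (ι → ℝ) →L[ℝ] (ι → ℝ) := ∑ i, ∑ j, g.inner y (s i y) (s j y) • L i j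
  let β (y : M) : ι → ℝ := fun j => g.inner y (V y) (s j y)
  have hΦ_apply (y : M) (c : ι → ℝ) (j : ι) :
      Φ y c j = g.inner y (∑ i, c i • s i y) (s j y) := by
    simp [Φ, L, Finset.sum_apply, Pi.single_apply, mul_comm]
  let c (y : M) : ι → ℝ := (Φ y).inverse (β y)
  have hc : ∀ᶠ y in 𝓝 x, (Φ y).IsInvertible ∧ V y = ∑ i, c y i • s i y := by
    filter_upwards [hb] with y ⟨b, hb⟩
    have hinj : Function.Injective (Φ y).toLinearMap := by
      rw [injective_iff_map_eq_zero]
      intro d hd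
      have h0 (j : ι) : g.inner y (∑ i, d i • s i y) (s j y) = 0 := by
        rw [← hΦ_apply]; exact congrFun hd j
      -- A vector in the span of the frame that is orthogonal to every member of the frame is
      -- orthogonal to itself.
      have h1 : ∑ i, d i • s i y = 0 := by
        by_contra hne
        refine (g.pos y _ hne).ne' ?_
        rw [map_sum]
        exact Finset.sum_eq_zero fun j _ => by simp only [map_smul, h0, smul_zero]
      have := b.linearIndependent
      rw [Fintype.linearIndependent_iff] at this
      exact funext (this d (by simpa only [hb] using h1))
    have hinv : (Φ y).IsInvertible :=
      ⟨(LinearEquiv.ofInjectiveEndo _ hinj).toContinuousLinearEquiv, by ext; rfl⟩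
    refine ⟨hinv, ?_⟩
    have h2 : Φ y (b.repr (V y)) = β y := by
      funext j
      rw [hΦ_apply]
      simp only [← hb, b.sum_repr, β]
    have h3 : c y = b.repr (V y) := by
      obtain ⟨e, he⟩ := hinv
      simp only [c, ← h2, ← he]
      simp
    simp only [h3, ← hb, b.sum_repr]
  have hsm (i : ι) : SmoothFunNear I (fun y => c y i) x := by
    have h1 : ∀ᶠ y in 𝓝 x, ∀ i j, CMDiffAt ∞ (fun y => g.inner y (s i y) (s j y)) y := by
      rw [eventually_all]; intro i; rw [eventually_all]; intro j
      exact (hs i).inner g (hs j)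
    have h2 : ∀ᶠ y in 𝓝 x, ∀ j, CMDiffAt ∞ (fun y => g.inner y (V y) (s j y)) y := by
      rw [eventually_all]; intro j
      exact h j
    filter_upwards [h1, h2, hc] with y h1 h2 h3
    have hΦ : ContMDiffAt I 𝓘(ℝ, (ι → ℝ) →L[ℝ] (ι → ℝ)) ∞ Φ y :=
      ContMDiffAt.sum fun i _ => ContMDiffAt.sum fun j _ => (h1 i j).smul contMDiffAt_const
    have hβ : ContMDiffAt I 𝓘(ℝ, ι → ℝ) ∞ β y := contMDiffAt_pi_space.2 h2
    -- Inversion of operators is smooth at an invertible operator.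
    have hinv : ContMDiffAt I 𝓘(ℝ, (ι → ℝ) →L[ℝ] (ι → ℝ)) ∞ (fun y => (Φ y).inverse) y :=
      (h3.1.contDiffAt_map_inverse.contMDiffAt).comp y hΦ
    exact contMDiffAt_pi_space.1 (hinv.clm_apply hβ) i
  exact ⟨fun i y => c y i, hsm, hc.mono fun y hy => hy.2⟩

variable [FiniteDimensional ℝ E]

variable (I) in
/-- Near every point there is a frame of smooth vector fields. -/
theorem exists_smooth_frame (x : M) : ∃ s : Fin (Module.finrank ℝ E) → Π y : M, TangentSpace I y,
    (∀ i, SmoothNear (s i) x) ∧ ∀ᶠ y in 𝓝 x, ∃ b : Module.Basis (Fin (Module.finrank ℝ E)) ℝ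
      (TangentSpace I y), ∀ i, b i = s i y := by
  let t := trivializationAt E (TangentSpace I (M := M)) x
  let b := Module.finBasis ℝ E
  have hx : x ∈ t.baseSet := FiberBundle.mem_baseSet_trivializationAt E (TangentSpace I) x
  have ht : ∀ᶠ y in 𝓝 x, y ∈ t.baseSet := t.open_baseSet.mem_nhds hx
  refine ⟨t.localFrame b, fun i => ?_, ?_⟩
  · filter_upwards [ht] with y hy
    exact contMDiffAt_localFrame_of_mem ∞ _ b i hy
  · filter_upwards [ht] with y hy
    exact ⟨t.basisAt b hy, fun i => (t.localFrame_apply_of_mem_baseSet b hy).symm⟩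

/-- A vector field is smooth if its inner products with smooth vector fields are smooth. -/
theorem smoothNear_of_inner {V : Π x : M, TangentSpace I x}
    (h : ∀ W, SmoothNear W x → SmoothFunNear I (fun y => g.inner y (V y) (W y)) x) :
    SmoothNear V x := by
  obtain ⟨s, hs, hb⟩ := exists_smooth_frame I x
  obtain ⟨c, hc, hV⟩ := exists_smooth_coeff_of_inner hs hb fun i => h _ (hs i)
  exact (SmoothNear.sum (s := Finset.univ) fun i _ => SmoothNear.smul (hc i) (hs i)).congr hV

variable (g) in
/-- The covariant derivative `∇_X Y`. -/
def nabla (X Y : Π x : M, TangentSpace I x) (x : M) : TangentSpace I x := leviCivita g Y x (X x)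

/-- By the Koszul formula the inner products of `∇_X Y` with smooth fields are smooth, and this is
enough by `smoothNear_of_inner`. -/
theorem SmoothNear.nabla (hX : SmoothNear X x) (hY : SmoothNear Y x) :
    SmoothNear (nabla g X Y) x := by
  refine smoothNear_of_inner (g := g) fun W hW => ?_
  have hk : SmoothFunNear I (fun y => (1 / 2) * koszul g X Y W y) x := by
    refine (SmoothFunNear.const _).mul ?_
    exact ((((((hY.inner g hW).deriv hX).add ((hW.inner g hX).deriv hY)).sub
      ((hX.inner g hY).deriv hW)).add ((hX.mlieBracket hY).inner g hW)).sub
      ((hY.mlieBracket hW).inner g hX)).add ((hW.mlieBracket hX).inner g hY)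
  refine hk.congr ?_
  filter_upwards [hX.eventually, hY.eventually, hW.eventually] with y h1 h2 h3
  exact inner_leviCivitaFun g h1.mdifferentiableAt h2.mdifferentiableAt h3.mdifferentiableAt

theorem nabla_congr_right (hY : SmoothNear Y x) (h : ∀ᶠ y in 𝓝 x, Y' y = Y y) :
    nabla g X Y' x = nabla g X Y x :=
  DFunLike.congr_fun ((leviCivita g).isCovariantDerivativeOn.congr_of_eventuallyEq
    (hY.congr h).mdifferentiableAt hY.mdifferentiableAt univ_mem h) _

theorem nabla_add_right (hY : SmoothNear Y x) (hY' : SmoothNear Y' x) :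
    nabla g X (Y + Y') x = nabla g X Y x + nabla g X Y' x :=
  DFunLike.congr_fun ((leviCivita g).isCovariantDerivativeOn (s := Set.univ).add
    hY.mdifferentiableAt hY'.mdifferentiableAt) _

theorem nabla_smul_right (hf : MDiffAt f x) (hY : SmoothNear Y x) :
    nabla g X (f • Y) x = f x • nabla g X Y x + d% f x (X x) • Y x :=
  DFunLike.congr_fun ((leviCivita g).isCovariantDerivativeOn (s := Set.univ).leibniz
    hY.mdifferentiableAt hf) _

theorem nabla_neg_right (hY : SmoothNear Y x) : nabla g X (-Y) x = - nabla g X Y x := by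
  have h := DFunLike.congr_fun ((leviCivita g).isCovariantDerivativeOn (s := Set.univ).smul_const
    (-1 : ℝ) hY.mdifferentiableAt) (X x)
  simpa [nabla] using h

theorem nabla_sub_right (hY : SmoothNear Y x) (hY' : SmoothNear Y' x) :
    nabla g X (Y - Y') x = nabla g X Y x - nabla g X Y' x := by
  rw [sub_eq_add_neg, nabla_add_right hY hY'.neg, nabla_neg_right hY', sub_eq_add_neg]

theorem nabla_add_left : nabla g (X + X') Y x = nabla g X Y x + nabla g X' Y x :=
  map_add _ _ _

theorem nabla_smul_left : nabla g (f • X) Y x = f x • nabla g X Y x :=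
  map_smul (leviCivita g Y x) _ _

theorem nabla_sum_right {ι : Type*} (s : Finset ι) {Y : ι → Π x : M, TangentSpace I x}
    (hY : ∀ i ∈ s, SmoothNear (Y i) x) :
    nabla g X (fun y => ∑ i ∈ s, Y i y) x = ∑ i ∈ s, nabla g X (Y i) x := by
  classical
  induction s using Finset.induction_on with
  | empty =>
    simp only [Finset.sum_empty]
    exact DFunLike.congr_fun (congrFun (leviCivita g).zero x) (X x)
  | insert a s ha ih =>
    simp only [Finset.sum_insert ha]
    have h := Finset.forall_mem_insert _ _ _ |>.1 hY
    rw [← ih h.2]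
    exact nabla_add_right h.1 (SmoothNear.sum h.2)

theorem nabla_metric (hX : SmoothNear X x) (hY : SmoothNear Y x) (hZ : SmoothNear Z x) :
    d% (fun y => g.inner y (Y y) (Z y)) x (X x) =
      g.inner x (nabla g X Y x) (Z x) + g.inner x (Y x) (nabla g X Z x) :=
  leviCivita_metric g hX.mdifferentiableAt hY.mdifferentiableAt hZ.mdifferentiableAt

theorem nabla_torsion_free (hX : SmoothNear X x) (hY : SmoothNear Y x) :
    nabla g X Y x - nabla g Y X x = mlieBracket I X Y x :=
  leviCivita_torsion_free g hX.mdifferentiableAt hY.mdifferentiableAt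

/-- Obtained from the Jacobi identity: expand it for `X`, `Y`, `fZ` by the Leibniz rule and subtract
`f` times the identity for `X`, `Y`, `Z`. The mixed first-order terms cancel, and only multiples of
`Z` remain. -/
theorem mvfderiv_mlieBracket_smul (hX : SmoothNear X x) (hY : SmoothNear Y x)
    (hZ : SmoothNear Z x) (hf : SmoothFunNear I f x) :
    d% f x (mlieBracket I X Y x) • Z x =
      (d% (fun y => d% f y (Y y)) x (X x) - d% (fun y => d% f y (X y)) x (Y x)) • Z x := by
  have key {A B : Π x : M, TangentSpace I x} (hA : SmoothNear A x) (hB : SmoothNear B x) :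
      mlieBracket I A (mlieBracket I B (f • Z)) x =
        d% (fun y => d% f y (B y)) x (A x) • Z x + d% f x (B x) • mlieBracket I A Z x
          + (d% f x (A x) • mlieBracket I B Z x + f x • mlieBracket I A (mlieBracket I B Z) x) := by
    have e : mlieBracket I B (f • Z) =ᶠ[𝓝 x]
        (fun y => d% f y (B y)) • Z + f • mlieBracket I B Z := by
      filter_upwards [hZ.eventually, hf.eventually] with y h1 h2
      exact mlieBracket_smul_right h2.mdifferentiableAt h1.mdifferentiableAt
    have hd := hf.deriv hB
    have hBZ := hB.mlieBracket hZ
    rw [EventuallyEq.mlieBracket_vectorField_eq (EventuallyEq.refl _ A) e,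
      mlieBracket_add_right (SmoothNear.smul hd hZ).mdifferentiableAt
        (SmoothNear.smul hf hBZ).mdifferentiableAt,
      mlieBracket_smul_right hd.mdifferentiableAt hZ.mdifferentiableAt,
      mlieBracket_smul_right hf.mdifferentiableAt hBZ.mdifferentiableAt]
  have h1 := mlieBracket_jacobi hX hY (SmoothNear.smul hf hZ)
  have h2 := mlieBracket_jacobi hX hY hZ
  rw [key hX hY, key hY hX, h2,
    mlieBracket_smul_right hf.mdifferentiableAt hZ.mdifferentiableAt] at h1
  linear_combination (norm := module) (-1 : ℝ) • h1

theorem mvfderiv_mlieBracket (hX : SmoothNear X x) (hY : SmoothNear Y x)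
    (hf : SmoothFunNear I f x) :
    d% f x (mlieBracket I X Y x) =
      d% (fun y => d% f y (Y y)) x (X x) - d% (fun y => d% f y (X y)) x (Y x) := by
  by_cases h : ∃ u : TangentSpace I x, u ≠ 0
  · obtain ⟨u, hu⟩ := h
    have := mvfderiv_mlieBracket_smul hX hY (smoothNear_extend u) hf
    rw [extend_apply_self] at this
    exact smul_left_injective ℝ hu this
  -- In a zero tangent space all the directions vanish, and so do both sides.
  · push Not at h
    simp [h (X x), h (Y x), h (mlieBracket I X Y x)]

end Connection

/-! ### Tensoriality of the curvature and its algebraic symmetries. -/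

section Curvature

variable {E : Type*} [NormedAddCommGroup E] [NormedSpace ℝ E]
  {H : Type*} [TopologicalSpace H] {I : ModelWithCorners ℝ E H}
  {M : Type*} [TopologicalSpace M] [ChartedSpace H M] [IsManifold I ∞ M]
  {g : ContMDiffRiemannianMetric I ∞ E (fun x : M => TangentSpace I x)}
  {X X' Y Y' Z Z' W : Π x : M, TangentSpace I x} {f : M → ℝ} {x : M}

/-- An operation on vector fields which is additive, and linear over functions, on vector fields
that are smooth near `x`. -/
structure SmoothTensorialAt {A : Type*} [AddCommGroup A] [Module ℝ A]
    (Φ : (Π x : M, TangentSpace I x) → A) (x : M) : Prop where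
  smul : ∀ {f : M → ℝ} {X}, SmoothFunNear I f x → SmoothNear X x → Φ (f • X) = f x • Φ X
  add : ∀ {X Y}, SmoothNear X x → SmoothNear Y x → Φ (X + Y) = Φ X + Φ Y

namespace SmoothTensorialAt

variable {A : Type*} [AddCommGroup A] [Module ℝ A] {Φ : (Π x : M, TangentSpace I x) → A}

theorem congr (hΦ : SmoothTensorialAt Φ x) (hX : SmoothNear X x)
    (h : ∀ᶠ y in 𝓝 x, X' y = X y) : Φ X' = Φ X := by
  classical
  -- This indicator is identically 1 near `x`, hence smooth there, and `ψ • X'` and `ψ • X` agree on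
  -- the whole manifold, so linearity over functions applies without a bump function.
  let ψ (y : M) : ℝ := if X' y = X y then 1 else 0
  have hψ : SmoothFunNear I ψ x :=
    (SmoothFunNear.const 1).congr (h.mono fun y hy => by simp [ψ, hy])
  have hx : ψ x = 1 := by simp [ψ, h.self_of_nhds]
  have e : ψ • X' = ψ • X := by
    funext y
    by_cases hy : X' y = X y <;> simp [ψ, hy]
  have h1 := hΦ.smul hψ (hX.congr h)
  have h2 := hΦ.smul hψ hX
  rw [hx, one_smul] at h1 h2
  rw [← h1, ← h2, e]

theorem sum (hΦ : SmoothTensorialAt Φ x) {ι : Type*} (s : Finset ι)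
    {X : ι → Π x : M, TangentSpace I x} (hX : ∀ i ∈ s, SmoothNear (X i) x) :
    Φ (fun y => ∑ i ∈ s, X i y) = ∑ i ∈ s, Φ (X i) := by
  classical
  induction s using Finset.induction_on with
  | empty =>
    have h0 : SmoothNear (fun _ => 0 : Π x : M, TangentSpace I x) x := by
      simpa using SmoothNear.sum (s := ∅) (X := X) (x := x) (by simp)
    have := hΦ.add h0 h0
    rw [show (fun _ => 0 : Π x : M, TangentSpace I x) + (fun _ => 0) = fun _ => 0 from
      add_zero _] at this
    simpa using this
  | insert a s ha ih =>
    simp only [Finset.sum_insert ha]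
    have h := Finset.forall_mem_insert _ _ _ |>.1 hX
    rw [← ih h.2]
    exact hΦ.add h.1 (SmoothNear.sum h.2)

variable [FiniteDimensional ℝ E]

/-- The difference of the two fields expands in a smooth frame with smooth coefficients that vanish
at `x`; these values factor out of `Φ`. -/
theorem pointwise (g : ContMDiffRiemannianMetric I ∞ E (fun x : M => TangentSpace I x))
    (hΦ : SmoothTensorialAt Φ x) (hX : SmoothNear X x) (hX' : SmoothNear X' x) (h : X x = X' x) :
    Φ X = Φ X' := by
  obtain ⟨s, hs, hb⟩ := exists_smooth_frame I x
  have hD : SmoothNear (X - X') x := hX.sub hX'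
  obtain ⟨c, hc, hV⟩ := exists_smooth_coeff_of_inner (g := g) hs hb fun i => hD.inner g (hs i)
  have h0 (i) : c i x = 0 := by
    obtain ⟨b, hb⟩ := hb.self_of_nhds
    have hx := hV.self_of_nhds
    rw [Pi.sub_apply, h, sub_self] at hx
    refine Fintype.linearIndependent_iff.1 b.linearIndependent (fun i => c i x) ?_ i
    simpa only [hb] using hx.symm
  have hcs : ∀ i ∈ Finset.univ, SmoothNear (c i • s i) x := fun i _ => .smul (hc i) (hs i)
  have hz : Φ (X - X') = 0 := by
    rw [hΦ.congr (SmoothNear.sum hcs) hV, hΦ.sum _ hcs]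
    exact Finset.sum_eq_zero fun i _ => by rw [hΦ.smul (hc i) (hs i), h0, zero_smul]
  have := hΦ.add hX' hD
  rwa [add_sub_cancel, hz, add_zero] at this

end SmoothTensorialAt

variable [FiniteDimensional ℝ E]

theorem curvature_eq_nabla : curvature g X Y Z x =
    nabla g X (nabla g Y Z) x - nabla g Y (nabla g X Z) x - nabla g (mlieBracket I X Y) Z x :=
  rfl

theorem curvature_swap : curvature g X Y Z x = - curvature g Y X Z x := by
  simp only [curvature_eq_nabla, nabla, mlieBracket_swap_apply (V := X), map_neg]
  abel

theorem smoothTensorialAt_curvature_left (hZ : SmoothNear Z x) :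
    SmoothTensorialAt (curvature g · Y Z x) x where
  smul {f X} hf hX := by
    have h1 : nabla g (f • X) Z = f • nabla g X Z := funext fun y => nabla_smul_left
    have h2 : nabla g (mlieBracket I (f • X) Y) Z x =
        - d% f x (Y x) • nabla g X Z x + f x • nabla g (mlieBracket I X Y) Z x := by
      simp only [nabla, mlieBracket_smul_left hf.mdifferentiableAt hX.mdifferentiableAt, map_add,
        map_smul]
    simp only [curvature_eq_nabla, h1, h2, nabla_smul_left,
      nabla_smul_right hf.mdifferentiableAt (hX.nabla hZ)]
    module
  add {X X'} hX hX' := by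
    have h1 : nabla g (X + X') Z = nabla g X Z + nabla g X' Z := funext fun y => nabla_add_left
    have h2 : nabla g (mlieBracket I (X + X') Y) Z x =
        nabla g (mlieBracket I X Y) Z x + nabla g (mlieBracket I X' Y) Z x := by
      simp only [nabla, mlieBracket_add_left hX.mdifferentiableAt hX'.mdifferentiableAt, map_add]
    simp only [curvature_eq_nabla, h1, h2, nabla_add_left,
      nabla_add_right (hX.nabla hZ) (hX'.nabla hZ)]
    module

theorem smoothTensorialAt_curvature_middle (hZ : SmoothNear Z x) :
    SmoothTensorialAt (curvature g X · Z x) x where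
  smul {f Y} hf hY := by
    simp only [curvature_swap (X := X), (smoothTensorialAt_curvature_left hZ).smul hf hY,
      smul_neg]
  add {Y Y'} hY hY' := by
    simp only [curvature_swap (X := X), (smoothTensorialAt_curvature_left hZ).add hY hY',
      neg_add]

theorem smoothTensorialAt_curvature_right (hX : SmoothNear X x) (hY : SmoothNear Y x) :
    SmoothTensorialAt (curvature g X Y · x) x where
  smul {f Z} hf hZ := by
    have key {A B : Π x : M, TangentSpace I x} (hA : SmoothNear A x) (hB : SmoothNear B x) :
        nabla g A (nabla g B (f • Z)) x =
          f x • nabla g A (nabla g B Z) x + d% f x (A x) • nabla g B Z x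
          + (d% f x (B x) • nabla g A Z x + d% (fun y => d% f y (B y)) x (A x) • Z x) := by
      have e : ∀ᶠ y in 𝓝 x, nabla g B (f • Z) y =
          (f • nabla g B Z + (fun y => d% f y (B y)) • Z) y := by
        filter_upwards [hf.eventually, hZ.eventually] with y h1 h2
        exact nabla_smul_right h1.mdifferentiableAt h2
      have hBZ : SmoothNear (nabla g B Z) x := hB.nabla hZ
      have hd := hf.deriv hB
      rw [nabla_congr_right ((SmoothNear.smul hf hBZ).add (SmoothNear.smul hd hZ)) e,
        nabla_add_right (SmoothNear.smul hf hBZ) (SmoothNear.smul hd hZ),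
        nabla_smul_right hf.mdifferentiableAt hBZ, nabla_smul_right hd.mdifferentiableAt hZ]
    simp only [curvature_eq_nabla, key hX hY, key hY hX,
      nabla_smul_right hf.mdifferentiableAt hZ, mvfderiv_mlieBracket hX hY hf]
    module
  add {Z Z'} hZ hZ' := by
    have key {A B : Π x : M, TangentSpace I x} (hB : SmoothNear B x) :
        nabla g A (nabla g B (Z + Z')) x =
          nabla g A (nabla g B Z) x + nabla g A (nabla g B Z') x := by
      have e : ∀ᶠ y in 𝓝 x, nabla g B (Z + Z') y = (nabla g B Z + nabla g B Z') y := by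
        filter_upwards [hZ.eventually, hZ'.eventually] with y h1 h2
        exact nabla_add_right h1 h2
      have hBZ : SmoothNear (nabla g B Z) x := hB.nabla hZ
      have hBZ' : SmoothNear (nabla g B Z') x := hB.nabla hZ'
      rw [nabla_congr_right (hBZ.add hBZ') e, nabla_add_right hBZ hBZ']
    simp only [curvature_eq_nabla, key hX, key hY, nabla_add_right hZ hZ']
    module

variable (g) in
/-- The curvature tensor at `x`. -/
def riemann (x : M) (u v w : TangentSpace I x) : TangentSpace I x :=
  curvature g (extend E u) (extend E v) (extend E w) x

theorem curvature_eq_riemann (hX : SmoothNear X x) (hY : SmoothNear Y x) (hZ : SmoothNear Z x) :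
    curvature g X Y Z x = riemann g x (X x) (Y x) (Z x) := by
  have hu := smoothNear_extend (X x)
  have hv := smoothNear_extend (Y x)
  have hw := smoothNear_extend (Z x)
  rw [riemann,
    (smoothTensorialAt_curvature_left hZ).pointwise g hX hu (by simp),
    (smoothTensorialAt_curvature_middle hZ).pointwise g hY hv (by simp),
    (smoothTensorialAt_curvature_right hu hv).pointwise g hZ hw (by simp)]

variable {u u' v v' w w' z : TangentSpace I x}

theorem riemann_add_left : riemann g x (u + u') v w = riemann g x u v w + riemann g x u' v w := by
  have hv := smoothNear_extend v
  have hw := smoothNear_extend w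
  have h := (smoothTensorialAt_curvature_left (g := g) (Y := extend E v) hw).add
    (smoothNear_extend u)
    (smoothNear_extend u')
  rw [curvature_eq_riemann ((smoothNear_extend u).add (smoothNear_extend u')) hv hw] at h
  simp only [Pi.add_apply, extend_apply_self] at h
  exact h

theorem riemann_smul_left (c : ℝ) : riemann g x (c • u) v w = c • riemann g x u v w := by
  have hv := smoothNear_extend v
  have hw := smoothNear_extend w
  have h := (smoothTensorialAt_curvature_left (g := g) (Y := extend E v) hw).smul
    (SmoothFunNear.const c)
    (smoothNear_extend u)
  rw [curvature_eq_riemann (SmoothNear.smul (SmoothFunNear.const c) (smoothNear_extend u)) hv hw]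
    at h
  simp only [Pi.smul_apply', extend_apply_self] at h
  exact h

theorem riemann_swap : riemann g x u v w = - riemann g x v u w := curvature_swap

theorem riemann_smul_middle (c : ℝ) : riemann g x u (c • v) w = c • riemann g x u v w := by
  rw [riemann_swap, riemann_smul_left, ← smul_neg, ← riemann_swap]

/-- Apply `[X,Y] = XY - YX` to the function `g(Z,W)` and expand by metric compatibility; the mixed
products of first derivatives cancel. -/
theorem curvature_metric (hX : SmoothNear X x) (hY : SmoothNear Y x) (hZ : SmoothNear Z x)
    (hW : SmoothNear W x) :
    g.inner x (curvature g X Y Z x) (W x) + g.inner x (Z x) (curvature g X Y W x) = 0 := by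
  have key {A B : Π x : M, TangentSpace I x} (hA : SmoothNear A x) (hB : SmoothNear B x) :
      d% (fun y => d% (fun y => g.inner y (Z y) (W y)) y (B y)) x (A x) =
        g.inner x (nabla g A (nabla g B Z) x) (W x) + g.inner x (nabla g B Z x) (nabla g A W x)
        + (g.inner x (nabla g A Z x) (nabla g B W x)
          + g.inner x (Z x) (nabla g A (nabla g B W) x)) := by
    have hBZ : SmoothNear (nabla g B Z) x := hB.nabla hZ
    have hBW : SmoothNear (nabla g B W) x := hB.nabla hW
    have e : ∀ᶠ y in 𝓝 x, d% (fun y => g.inner y (Z y) (W y)) y (B y) =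
        g.inner y (nabla g B Z y) (W y) + g.inner y (Z y) (nabla g B W y) := by
      filter_upwards [hB.eventually, hZ.eventually, hW.eventually] with y h1 h2 h3
      exact nabla_metric h1 h2 h3
    rw [mvfderiv_congr e, mvfderiv_fun_add (hBZ.inner g hW).mdifferentiableAt
      (hZ.inner g hBW).mdifferentiableAt, add_apply, nabla_metric hA hBZ hW,
      nabla_metric hA hZ hBW]
  have h := mvfderiv_mlieBracket hX hY (hZ.inner g hW)
  rw [nabla_metric (hX.mlieBracket hY) hZ hW, key hX hY, key hY hX] at h
  simp only [curvature_eq_nabla, map_sub, sub_apply]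
  linear_combination -h

/-- Vanishing torsion turns the cyclic sum into the cyclic sum of double brackets, which is zero by
Jacobi. -/
theorem curvature_bianchi (hX : SmoothNear X x) (hY : SmoothNear Y x) (hZ : SmoothNear Z x) :
    curvature g X Y Z x + curvature g Y Z X x + curvature g Z X Y x = 0 := by
  have key {A B C : Π x : M, TangentSpace I x} (hA : SmoothNear A x) (hB : SmoothNear B x)
      (hC : SmoothNear C x) :
      nabla g A (nabla g B C) x - nabla g A (nabla g C B) x - nabla g (mlieBracket I B C) A x =
        mlieBracket I A (mlieBracket I B C) x := by
    have hBC : SmoothNear (nabla g B C) x := hB.nabla hC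
    have hCB : SmoothNear (nabla g C B) x := hC.nabla hB
    have e : ∀ᶠ y in 𝓝 x, (nabla g B C - nabla g C B) y = mlieBracket I B C y := by
      filter_upwards [hB.eventually, hC.eventually] with y h1 h2
      exact nabla_torsion_free h1 h2
    rw [← nabla_sub_right hBC hCB, nabla_congr_right (hB.mlieBracket hC) e,
      nabla_torsion_free hA (hB.mlieBracket hC)]
  have h1 := key hX hY hZ
  have h2 := key hY hZ hX
  have h3 := key hZ hX hY
  have h4 := mlieBracket_jacobi hX hY hZ
  rw [mlieBracket_swap_apply (V := mlieBracket I X Y)] at h4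
  have h5 : mlieBracket I Y (mlieBracket I X Z) x = - mlieBracket I Y (mlieBracket I Z X) x := by
    have e : mlieBracket I X Z = (-1 : ℝ) • mlieBracket I Z X := by
      rw [mlieBracket_swap, neg_one_smul]
    rw [e, mlieBracket_const_smul_right (hZ.mlieBracket hX).mdifferentiableAt, neg_one_smul]
  rw [h5] at h4
  simp only [curvature_eq_nabla]
  linear_combination (norm := module) (1 : ℝ) • h1 + (1 : ℝ) • h2 + (1 : ℝ) • h3 + (1 : ℝ) • h4

theorem riemann_metric :
    g.inner x (riemann g x u v w) z + g.inner x w (riemann g x u v z) = 0 := by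
  have h := curvature_metric (g := g) (smoothNear_extend u) (smoothNear_extend v)
    (smoothNear_extend w) (smoothNear_extend z)
  simp only [extend_apply_self] at h
  exact h

theorem riemann_bianchi : riemann g x u v w + riemann g x v w u + riemann g x w u v = 0 :=
  curvature_bianchi (smoothNear_extend u) (smoothNear_extend v) (smoothNear_extend w)

theorem riemann_pair_symm :
    g.inner x (riemann g x u v w) z = g.inner x (riemann g x w z u) v := by
  have b (a b c d : TangentSpace I x) : g.inner x (riemann g x a b c) d +
      g.inner x (riemann g x b c a) d + g.inner x (riemann g x c a b) d = 0 := by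
    simpa only [map_add, add_apply, map_zero, zero_apply] using
      congrArg (fun t => g.inner x t d) (riemann_bianchi (g := g) (u := a) (v := b) (w := c))
  have a1 (a b c d : TangentSpace I x) :
      g.inner x (riemann g x a b c) d = - g.inner x (riemann g x b a c) d := by
    rw [riemann_swap, map_neg, neg_apply]
  have a2 (a b c d : TangentSpace I x) :
      g.inner x (riemann g x a b c) d = - g.inner x (riemann g x a b d) c := by
    have := riemann_metric (g := g) (u := a) (v := b) (w := c) (z := d)
    rw [g.symm x c] at this
    linarith
  -- The octahedron argument: the first Bianchi identity with each of the four vectors in turn in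
  -- the last slot, combined with the two antisymmetries.
  linarith [b u v w z, b v w z u, b w z u v, b z u v w, a1 u v w z, a2 u v w z, a1 v w u z,
    a2 v w u z, a1 w u v z, a2 w u v z, a1 v w z u, a2 v w z u, a1 w z v u, a2 w z v u,
    a1 z v w u, a2 z v w u, a1 w z u v, a2 w z u v, a1 z u w v, a2 z u w v, a1 u w z v,
    a2 u w z v, a1 z u v w, a2 z u v w, a1 u v z w, a2 u v z w, a1 v z u w, a2 v z u w]

variable (g) in
/-- The endomorphism `u ↦ R(u, v)w`. -/
def riemannEnd (x : M) (v w : TangentSpace I x) : TangentSpace I x →ₗ[ℝ] TangentSpace I x where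
  toFun u := riemann g x u v w
  map_add' _ _ := riemann_add_left
  map_smul' c _ := riemann_smul_left c

theorem ricci_eq_trace : ricci g x v w = LinearMap.trace ℝ _ (riemannEnd g x v w) := by
  rw [LinearMap.trace_eq_matrix_trace ℝ (Module.finBasis ℝ (TangentSpace I x))]
  simp [ricci, Matrix.trace, LinearMap.toMatrix_apply, riemannEnd, riemann]

end Curvature

/-! ### The second Bianchi identity and derivatives of traces. -/

section Bianchi

variable {E : Type*} [NormedAddCommGroup E] [NormedSpace ℝ E] [FiniteDimensional ℝ E]
  {H : Type*} [TopologicalSpace H] {I : ModelWithCorners ℝ E H}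
  {M : Type*} [TopologicalSpace M] [ChartedSpace H M] [IsManifold I ∞ M]
  {g : ContMDiffRiemannianMetric I ∞ E (fun x : M => TangentSpace I x)}
  {X Y Z W : Π x : M, TangentSpace I x} {x : M}

theorem SmoothNear.curvature (hX : SmoothNear X x) (hY : SmoothNear Y x) (hZ : SmoothNear Z x) :
    SmoothNear (curvature g X Y Z) x :=
  ((hX.nabla (hY.nabla hZ)).sub (hY.nabla (hX.nabla hZ))).sub ((hX.mlieBracket hY).nabla hZ)

/-- The second Bianchi identity. -/
theorem curvature_second_bianchi (hX : SmoothNear X x) (hY : SmoothNear Y x)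
    (hW : SmoothNear W x) (hZ : SmoothNear Z x) :
    nabla g X (curvature g Y W Z) x - curvature g Y W (nabla g X Z) x
        - curvature g (mlieBracket I X Y) W Z x
      + (nabla g Y (curvature g W X Z) x - curvature g W X (nabla g Y Z) x
        - curvature g (mlieBracket I Y W) X Z x)
      + (nabla g W (curvature g X Y Z) x - curvature g X Y (nabla g W Z) x
        - curvature g (mlieBracket I W X) Y Z x) = 0 := by
  have key {A B C : Π x : M, TangentSpace I x} (hB : SmoothNear B x) (hC : SmoothNear C x) :
      nabla g A (curvature g B C Z) x = nabla g A (nabla g B (nabla g C Z)) x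
        - nabla g A (nabla g C (nabla g B Z)) x - nabla g A (nabla g (mlieBracket I B C) Z) x := by
    have h1 : SmoothNear (nabla g B (nabla g C Z)) x := hB.nabla (hC.nabla hZ)
    have h2 : SmoothNear (nabla g C (nabla g B Z)) x := hC.nabla (hB.nabla hZ)
    have h3 : SmoothNear (nabla g (mlieBracket I B C) Z) x := (hB.mlieBracket hC).nabla hZ
    rw [← nabla_sub_right h1 h2, ← nabla_sub_right (h1.sub h2) h3]
    rfl
  -- After expansion the third-order terms cancel in pairs; what is left is `∇Z` along the cyclic
  -- sum of double brackets.
  have hj : nabla g (mlieBracket I (mlieBracket I X Y) W) Z x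
      + nabla g (mlieBracket I (mlieBracket I Y W) X) Z x
      + nabla g (mlieBracket I (mlieBracket I W X) Y) Z x = 0 := by
    have h := mlieBracket_jacobi hX hY hW
    have e : mlieBracket I X W = (-1 : ℝ) • mlieBracket I W X := by
      rw [mlieBracket_swap, neg_one_smul]
    rw [e, mlieBracket_const_smul_right (hW.mlieBracket hX).mdifferentiableAt, neg_one_smul] at h
    rw [mlieBracket_swap_apply (V := X), mlieBracket_swap_apply (V := Y)] at h
    simp only [nabla, ← map_add]
    rw [show mlieBracket I (mlieBracket I X Y) W x + mlieBracket I (mlieBracket I Y W) X x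
      + mlieBracket I (mlieBracket I W X) Y x = 0 by
        linear_combination (norm := module) (-1 : ℝ) • h, map_zero]
  rw [key hY hW, key hW hX, key hX hY]
  simp only [curvature_eq_nabla]
  linear_combination (norm := module) (1 : ℝ) • hj

/-- The derivative of the trace of a field of endomorphisms is the trace of its covariant
derivative. -/
theorem mvfderiv_trace (g : ContMDiffRiemannianMetric I ∞ E (fun x : M => TangentSpace I x))
    {U : Π x : M, TangentSpace I x}
    (A : Π y : M, TangentSpace I y →ₗ[ℝ] TangentSpace I y)
    (hA : ∀ X, SmoothNear X x → SmoothNear (fun y => A y (X y)) x)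
    (B : TangentSpace I x →ₗ[ℝ] TangentSpace I x)
    (hB : ∀ X, SmoothNear X x →
      B (X x) = nabla g U (fun y => A y (X y)) x - A x (nabla g U X x)) :
    d% (fun y => LinearMap.trace ℝ _ (A y)) x (U x) = LinearMap.trace ℝ _ B := by
  obtain ⟨s, hs, hb⟩ := exists_smooth_frame I x
  choose a ha hV using fun i => exists_smooth_coeff_of_inner (g := g) hs hb
    fun j => (hA _ (hs i)).inner g (hs j)
  have hV' : ∀ᶠ y in 𝓝 x, ∀ i, A y (s i y) = ∑ j, a i j y • s j y := by
    rw [eventually_all]; exact hV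
  have htr : ∀ᶠ y in 𝓝 x, LinearMap.trace ℝ _ (A y) = ∑ i, a i i y := by
    filter_upwards [hb, hV'] with y ⟨b, hb⟩ hV
    rw [LinearMap.trace_eq_matrix_trace ℝ b]
    simp only [Matrix.trace, Matrix.diag, LinearMap.toMatrix_apply]
    refine Finset.sum_congr rfl fun i _ => ?_
    rw [hb, hV]
    simp only [← hb, b.repr_sum_self]
  obtain ⟨b, hb⟩ := hb.self_of_nhds
  -- `N` is the connection matrix of the frame and `D` the entrywise derivative of the matrix of
  -- `A`. In these terms the covariant derivative is `B = [N, A] + D`, and the commutator has trace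
  -- zero.
  let N : TangentSpace I x →ₗ[ℝ] TangentSpace I x := b.constr ℝ fun i => nabla g U (s i) x
  let D : TangentSpace I x →ₗ[ℝ] TangentSpace I x :=
    b.constr ℝ fun i => ∑ j, d% (a i j) x (U x) • b j
  have hBD : B = N ∘ₗ A x - A x ∘ₗ N + D := by
    refine b.ext fun i => ?_
    have h1 : nabla g U (fun y => A y (s i y)) x =
        ∑ j, (a i j x • nabla g U (s j) x + d% (a i j) x (U x) • s j x) := by
      have hsm : ∀ j ∈ Finset.univ, SmoothNear (a i j • s j) x := fun j _ => .smul (ha i j) (hs j)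
      rw [nabla_congr_right (SmoothNear.sum hsm) (hV i), nabla_sum_right _ hsm]
      exact Finset.sum_congr rfl fun j _ => nabla_smul_right (ha i j).mdifferentiableAt (hs j)
    have h2 : N (A x (b i)) = ∑ j, a i j x • nabla g U (s j) x := by
      rw [hb, hV'.self_of_nhds, map_sum]
      refine Finset.sum_congr rfl fun j _ => ?_
      rw [map_smul, ← hb, b.constr_basis]
    simp only [LinearMap.add_apply, LinearMap.sub_apply, LinearMap.comp_apply, h2]
    rw [b.constr_basis, b.constr_basis, hb, hB _ (hs i), h1, Finset.sum_add_distrib]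
    simp only [hb]
    abel
  have hD : LinearMap.trace ℝ _ D = ∑ i, d% (a i i) x (U x) := by
    rw [LinearMap.trace_eq_matrix_trace ℝ b]
    simp only [Matrix.trace, Matrix.diag, LinearMap.toMatrix_apply]
    refine Finset.sum_congr rfl fun i _ => ?_
    rw [b.constr_basis, b.repr_sum_self]
  have hsum (t : Finset (Fin (Module.finrank ℝ E))) : MDiffAt (fun y => ∑ i ∈ t, a i i y) x ∧
      d% (fun y => ∑ i ∈ t, a i i y) x (U x) = ∑ i ∈ t, d% (a i i) x (U x) := by
    classical
    induction t using Finset.induction_on with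
    | empty => exact ⟨by simpa using mdifferentiableAt_const, by simp [mvfderiv_const]⟩
    | insert i t hi ih =>
      simp only [Finset.sum_insert hi]
      exact ⟨(ha i i).mdifferentiableAt.add ih.1, by
        rw [mvfderiv_fun_add (ha i i).mdifferentiableAt ih.1, add_apply, ih.2]⟩
  rw [mvfderiv_congr htr, (hsum _).2, hBD, map_add, map_sub, ← hD]
  rw [← Module.End.mul_eq_comp, ← Module.End.mul_eq_comp, LinearMap.trace_mul_comm]
  simp

end Bianchi

/-! ### Para-Sasaki-like structures: the Reeb field and the curvature. -/

namespace RiemannianPiStructure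

variable {E : Type*} [NormedAddCommGroup E] [NormedSpace ℝ E]
  {H : Type*} [TopologicalSpace H] {I : ModelWithCorners ℝ E H}
  {M : Type*} [TopologicalSpace M] [ChartedSpace H M] [IsManifold I ∞ M]
  (S : RiemannianPiStructure I M) {X Y Z : Π x : M, TangentSpace I x} {x : M}
  {u v w : TangentSpace I x}

theorem smoothNear_φ (hX : SmoothNear X x) : SmoothNear (fun y => S.φ y (X y)) x := by
  filter_upwards [hX] with y h
  exact ContMDiffAt.clm_bundle_apply (S.φ_smooth y) h

theorem smoothNear_ξ : SmoothNear S.ξ x := .of_forall fun y => S.ξ_smooth y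

theorem inner_ξ : S.g.inner x u (S.ξ x) = S.η x u := by
  have h := S.compat x u (S.ξ x)
  rw [S.φ_ξ, map_zero, S.η_ξ] at h
  linarith

theorem ξ_inner : S.g.inner x (S.ξ x) u = S.η x u := by rw [S.g.symm, inner_ξ]

theorem inner_φ : S.g.inner x (S.φ x u) w = S.g.inner x u (S.φ x w) := by
  have h := S.compat x u (S.φ x w)
  rw [S.φ_sq, map_sub, map_smul, inner_ξ, S.η_φ, S.η_φ] at h
  simpa using h

theorem smoothFunNear_η (hX : SmoothNear X x) : SmoothFunNear I (fun y => S.η y (X y)) x := by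
  refine (hX.inner S.g S.smoothNear_ξ).congr (.of_forall fun y => ?_)
  rw [inner_ξ]

variable [FiniteDimensional ℝ E]

/-- The right-hand side of the para-Sasaki-like condition. -/
def sasakiTensor (x : M) (u w : TangentSpace I x) : TangentSpace I x :=
  -(S.g.inner x u w • S.ξ x) - S.η x w • u + (2 * S.η x u * S.η x w) • S.ξ x

variable {S} (hS : S.IsParaSasakiLike)

include hS

/-- The hypothesis speaks of one chosen extension of a vector; tensoriality of `∇φ` carries it over
to every smooth field. -/
theorem nabla_φ (hY : SmoothNear Y x) :
    nabla S.g X (fun y => S.φ y (Y y)) x =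
      S.φ x (nabla S.g X Y x) + S.sasakiTensor x (X x) (Y x) := by
  have ht : SmoothTensorialAt (fun Y => nabla S.g X (fun y => S.φ y (Y y)) x
      - S.φ x (nabla S.g X Y x)) x :=
    { smul := fun {f Y} hf hY => by
        have e : (fun y => S.φ y ((f • Y) y)) = f • fun y => S.φ y (Y y) := by
          funext y; simp
        simp only [e, nabla_smul_right hf.mdifferentiableAt hY,
          nabla_smul_right hf.mdifferentiableAt (S.smoothNear_φ hY), map_add, map_smul]
        module
      add := fun {Y Y'} hY hY' => by
        have e : (fun y => S.φ y ((Y + Y') y)) =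
            (fun y => S.φ y (Y y)) + fun y => S.φ y (Y' y) := by
          funext y; simp
        simp only [e, nabla_add_right hY hY',
          nabla_add_right (S.smoothNear_φ hY) (S.smoothNear_φ hY'), map_add]
        module }
  have h := ht.pointwise S.g hY (smoothNear_extend (Y x)) (by simp)
  have h2 := hS x (X x) (Y x)
  rw [← sub_eq_iff_eq_add', h]
  exact h2

/-- Differentiating `φξ = 0` gives `φ(∇_X ξ) = X - η(X)ξ`. Apply `φ` again: since `g(ξ,ξ) = 1`, the
field `∇_X ξ` is orthogonal to `ξ`, where `φ²` is the identity. -/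
theorem nabla_ξ (hX : SmoothNear X x) : nabla S.g X S.ξ x = S.φ x (X x) := by
  have h1 := nabla_φ hS (X := X) (S.smoothNear_ξ (x := x))
  have e : (fun y => S.φ y (S.ξ y)) = 0 := funext fun y => S.φ_ξ y
  have h0 : nabla S.g X 0 x = 0 :=
    DFunLike.congr_fun (congrFun (leviCivita S.g).zero x) (X x)
  rw [e, h0, sasakiTensor, inner_ξ, S.η_ξ] at h1
  have h2 : S.η x (nabla S.g X S.ξ x) = 0 := by
    have h := nabla_metric (g := S.g) hX S.smoothNear_ξ S.smoothNear_ξ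
    rw [inner_ξ, ξ_inner, mvfderiv_congr (f := fun _ => (1 : ℝ))
      (.of_forall fun y => by rw [inner_ξ, S.η_ξ]), mvfderiv_const] at h
    simp at h
    linarith
  have h3 : S.φ x (S.φ x (nabla S.g X S.ξ x)) = S.φ x (X x) := by
    have h4 : S.φ x (nabla S.g X S.ξ x) = X x - S.η x (X x) • S.ξ x := by
      linear_combination (norm := module) (-1 : ℝ) • h1
    rw [h4, map_sub, map_smul, S.φ_ξ, smul_zero, sub_zero]
  rw [S.φ_sq, h2] at h3
  simpa using h3

theorem mvfderiv_η (hX : SmoothNear X x) (hY : SmoothNear Y x) :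
    d% (fun y => S.η y (Y y)) x (X x) =
      S.η x (nabla S.g X Y x) + S.g.inner x (S.φ x (X x)) (Y x) := by
  rw [mvfderiv_congr (f := fun y => S.g.inner y (Y y) (S.ξ y))
    (.of_forall fun y => by rw [inner_ξ]), nabla_metric hX hY S.smoothNear_ξ, inner_ξ,
    nabla_ξ hS hX, S.g.symm x (Y x)]

/-- Here `∇_A ∇_B ξ = ∇_A(φB) = φ(∇_A B) + (∇_A φ)B`. Antisymmetrised, the first term cancels
against the bracket term, and of `∇φ` only the part that is not symmetric survives. -/
theorem curvature_ξ (hX : SmoothNear X x) (hY : SmoothNear Y x) :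
    curvature S.g X Y S.ξ x = S.η x (X x) • Y x - S.η x (Y x) • X x := by
  have key {A B : Π x : M, TangentSpace I x} (hA : SmoothNear A x) (hB : SmoothNear B x) :
      nabla S.g A (nabla S.g B S.ξ) x =
        S.φ x (nabla S.g A B x) + S.sasakiTensor x (A x) (B x) := by
    rw [← nabla_φ hS hB]
    exact nabla_congr_right (S.smoothNear_φ hB) (hB.eventually.mono fun y hy => nabla_ξ hS hy)
  rw [curvature_eq_nabla, key hX hY, key hY hX, nabla_ξ hS (hX.mlieBracket hY),
    ← nabla_torsion_free (g := S.g) hX hY, map_sub]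
  simp only [sasakiTensor, S.g.symm x (Y x)]
  module

theorem riemann_ξ_right : riemann S.g x u v (S.ξ x) = S.η x u • v - S.η x v • u := by
  have h := curvature_ξ hS (smoothNear_extend u) (smoothNear_extend v)
  rw [curvature_eq_riemann (smoothNear_extend u) (smoothNear_extend v) S.smoothNear_ξ] at h
  simpa only [extend_apply_self] using h

theorem riemann_ξ_middle :
    riemann S.g x v (S.ξ x) w = S.g.inner x w v • S.ξ x - S.η x w • v := by
  rw [← sub_eq_zero]
  by_contra hne
  refine (S.g.pos x _ hne).ne' ?_
  set z := riemann S.g x v (S.ξ x) w - (S.g.inner x w v • S.ξ x - S.η x w • v) with hz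
  -- Only the first of the two copies of `z` is unfolded; the other serves as test vector for pair
  -- symmetry.
  conv_lhs => enter [1]; rw [hz]
  have h1 := riemann_pair_symm (g := S.g) (u := v) (v := S.ξ x) (w := w) (z := z)
  have h2 := riemann_metric (g := S.g) (u := w) (v := z) (w := v) (z := S.ξ x)
  rw [riemann_ξ_right hS] at h2
  simp only [map_sub, map_smul, sub_apply, smul_apply, smul_eq_mul, h1, ξ_inner] at h2 ⊢
  rw [S.g.symm x w v]
  linear_combination h2

/-- The covariant derivative `(∇_t P)(u, w)` of the tensor `P = ∇φ`. -/
theorem nabla_sasakiTensor (hX : SmoothNear X x) (hY : SmoothNear Y x) (hZ : SmoothNear Z x) :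
    nabla S.g X (fun y => S.sasakiTensor y (Y y) (Z y)) x =
      S.sasakiTensor x (nabla S.g X Y x) (Z x) + S.sasakiTensor x (Y x) (nabla S.g X Z x)
      + (-(S.g.inner x (Y x) (Z x)) • S.φ x (X x) - S.g.inner x (S.φ x (X x)) (Z x) • Y x
        + (2 * S.g.inner x (S.φ x (X x)) (Y x) * S.η x (Z x)) • S.ξ x
        + (2 * S.η x (Y x) * S.g.inner x (S.φ x (X x)) (Z x)) • S.ξ x
        + (2 * S.η x (Y x) * S.η x (Z x)) • S.φ x (X x)) := by
  have hg := hY.inner S.g hZ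
  have hηY := S.smoothFunNear_η hY
  have hηZ := S.smoothFunNear_η hZ
  have hc := (SmoothFunNear.const (I := I) (x := x) 2).mul hηY
  have hm := hc.mul hηZ
  have hξ := S.smoothNear_ξ (x := x)
  have e : (fun y => S.sasakiTensor y (Y y) (Z y)) =
      -((fun y => S.g.inner y (Y y) (Z y)) • S.ξ) - (fun y => S.η y (Z y)) • Y
        + (fun y => 2 * S.η y (Y y) * S.η y (Z y)) • S.ξ := by
    funext y; simp [sasakiTensor]
  rw [e, nabla_add_right ((SmoothNear.smul hg hξ).neg.sub (SmoothNear.smul hηZ hY))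
      (SmoothNear.smul hm hξ),
    nabla_sub_right (SmoothNear.smul hg hξ).neg (SmoothNear.smul hηZ hY),
    nabla_neg_right (SmoothNear.smul hg hξ), nabla_smul_right hg.mdifferentiableAt hξ,
    nabla_smul_right hηZ.mdifferentiableAt hY, nabla_smul_right hm.mdifferentiableAt hξ,
    mvfderiv_fun_mul hc.mdifferentiableAt hηZ.mdifferentiableAt,
    mvfderiv_fun_mul mdifferentiableAt_const hηY.mdifferentiableAt, mvfderiv_const,
    nabla_metric hX hY hZ, nabla_ξ hS hX]
  simp only [add_apply, smul_apply, smul_eq_mul, smul_zero, add_zero, mvfderiv_η hS hX hY,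
    mvfderiv_η hS hX hZ, sasakiTensor]
  module

/-- The commutator of the curvature with `φ`. -/
theorem curvature_φ (hX : SmoothNear X x) (hY : SmoothNear Y x) (hZ : SmoothNear Z x) :
    curvature S.g X Y (fun y => S.φ y (Z y)) x = S.φ x (curvature S.g X Y Z x)
      - S.g.inner x (Y x) (Z x) • S.φ x (X x) + S.g.inner x (X x) (Z x) • S.φ x (Y x)
      - S.g.inner x (S.φ x (X x)) (Z x) • Y x + S.g.inner x (S.φ x (Y x)) (Z x) • X x
      + (2 * (S.η x (Y x) * S.g.inner x (S.φ x (X x)) (Z x)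
        - S.η x (X x) * S.g.inner x (S.φ x (Y x)) (Z x))) • S.ξ x
      + (2 * S.η x (Z x)) • (S.η x (Y x) • S.φ x (X x) - S.η x (X x) • S.φ x (Y x)) := by
  have hP {A B : Π x : M, TangentSpace I x} (hA : SmoothNear A x) (hB : SmoothNear B x) :
      SmoothNear (fun y => S.sasakiTensor y (A y) (B y)) x :=
    (((SmoothNear.smul (hA.inner S.g hB) S.smoothNear_ξ).neg.sub
      (SmoothNear.smul (S.smoothFunNear_η hB) hA)).add
      (SmoothNear.smul (((SmoothFunNear.const 2).mul (S.smoothFunNear_η hA)).mul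
        (S.smoothFunNear_η hB)) S.smoothNear_ξ) :)
  have key {A B : Π x : M, TangentSpace I x} (hA : SmoothNear A x) (hB : SmoothNear B x) :
      nabla S.g A (nabla S.g B (fun y => S.φ y (Z y))) x =
        S.φ x (nabla S.g A (nabla S.g B Z) x) + S.sasakiTensor x (A x) (nabla S.g B Z x)
        + nabla S.g A (fun y => S.sasakiTensor y (B y) (Z y)) x := by
    have hBZ : SmoothNear (nabla S.g B Z) x := hB.nabla hZ
    rw [← nabla_φ hS hBZ, ← nabla_add_right (S.smoothNear_φ hBZ) (hP hB hZ)]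
    refine nabla_congr_right ((S.smoothNear_φ hBZ).add (hP hB hZ)) ?_
    filter_upwards [hB.eventually, hZ.eventually] with y h1 h2
    exact nabla_φ hS h2
  -- With `P = ∇φ`, the terms `P(X, ∇_Y Z)` and `P(Y, ∇_X Z)` cancel on antisymmetrising, and
  -- torsion-freeness removes `P([X,Y], Z)`. What remains is `(∇_X P)(Y,Z) - (∇_Y P)(X,Z)`.
  rw [curvature_eq_nabla, key hX hY, key hY hX, nabla_φ hS hZ,
    nabla_sasakiTensor hS hX hY hZ, nabla_sasakiTensor hS hY hX hZ,
    ← nabla_torsion_free (g := S.g) hX hY, curvature_eq_nabla]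
  have e : nabla S.g (mlieBracket I X Y) Z x =
      leviCivita S.g Z x (nabla S.g X Y x - nabla S.g Y X x) := by
    rw [nabla_torsion_free hX hY]; rfl
  have e2 : S.g.inner x (S.φ x (Y x)) (X x) = S.g.inner x (S.φ x (X x)) (Y x) := by
    rw [inner_φ, S.g.symm]
  simp only [sasakiTensor, map_sub, sub_apply, e2, e]
  module

theorem riemann_φ : riemann S.g x u v (S.φ x w) = S.φ x (riemann S.g x u v w)
      - S.g.inner x v w • S.φ x u + S.g.inner x u w • S.φ x v
      - S.g.inner x (S.φ x u) w • v + S.g.inner x (S.φ x v) w • u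
      + (2 * (S.η x v * S.g.inner x (S.φ x u) w - S.η x u * S.g.inner x (S.φ x v) w)) • S.ξ x
      + (2 * S.η x w) • (S.η x v • S.φ x u - S.η x u • S.φ x v) := by
  have hu := smoothNear_extend u
  have hv := smoothNear_extend v
  have hw := smoothNear_extend w
  have h := curvature_φ hS hu hv hw
  rw [curvature_eq_riemann hu hv (S.smoothNear_φ hw), curvature_eq_riemann hu hv hw] at h
  simpa only [extend_apply_self] using h

end RiemannianPiStructure

/-- The shape of the function is that of `ρ` in `ricci_of_soliton'`, evaluated on two vector fields.
-/
theorem mvfderiv_combination {E : Type*} [NormedAddCommGroup E] [NormedSpace ℝ E]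
    {H : Type*} [TopologicalSpace H] {I : ModelWithCorners ℝ E H}
    {M : Type*} [TopologicalSpace M] [ChartedSpace H M] {a p q r s : M → ℝ} {x : M} {b c : ℝ}
    {u : TangentSpace I x} (ha : MDiffAt a x) (hp : MDiffAt p x) (hq : MDiffAt q x)
    (hr : MDiffAt r x) (hs : MDiffAt s x) :
    d% (fun y => a y * p y - b * q y + c * (r y * s y)) x u =
      d% a x u * p x + a x * d% p x u - b * d% q x u
        + c * (d% r x u * s x + r x * d% s x u) := by
  have hc (d : ℝ) : MDiffAt (fun _ : M => d) x := mdifferentiableAt_const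
  have h1 : MDiffAt (fun y => a y * p y) x := ha.mul hp
  have h2 : MDiffAt (fun y => b * q y) x := (hc b).mul hq
  have h3 : MDiffAt (fun y => r y * s y) x := hr.mul hs
  have h4 : MDiffAt (fun y => c * (r y * s y)) x := (hc c).mul h3
  have h5 : MDiffAt (fun y => a y * p y - b * q y) x := h1.sub h2
  rw [mvfderiv_fun_add h5 h4, mvfderiv_fun_sub h1 h2, mvfderiv_fun_mul ha hp,
    mvfderiv_fun_mul (hc b) hq, mvfderiv_fun_mul (hc c) h3, mvfderiv_fun_mul hr hs,
    mvfderiv_const, mvfderiv_const]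
  simp only [add_apply, sub_apply, smul_apply, smul_eq_mul, smul_zero, add_zero]
  ring

/-! ### The Ricci tensor of a para-Sasaki-like manifold. -/

namespace RiemannianPiStructure

variable {E : Type*} [NormedAddCommGroup E] [NormedSpace ℝ E] [FiniteDimensional ℝ E]
  {H : Type*} [TopologicalSpace H] {I : ModelWithCorners ℝ E H}
  {M : Type*} [TopologicalSpace M] [ChartedSpace H M] [IsManifold I ∞ M]
  {S : RiemannianPiStructure I M} {X Y Z : Π x : M, TangentSpace I x} {x : M}
  {u v w : TangentSpace I x} (hS : S.IsParaSasakiLike)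

include hS

theorem ricci_ξ : ricci S.g x v (S.ξ x) = (1 - Module.finrank ℝ E) * S.η x v := by
  have e : riemannEnd S.g x v (S.ξ x) =
      (S.η x).toLinearMap.smulRight v - S.η x v • LinearMap.id := by
    ext u
    exact riemann_ξ_right hS
  rw [ricci_eq_trace, e, map_sub, map_smul, LinearMap.trace_smulRight, LinearMap.trace_id]
  change S.η x v - S.η x v * (Module.finrank ℝ E : ℝ) = _
  ring

/-- The trace is cyclic, so `φ` may be moved outside `R(·,v)w`; `riemann_φ` then moves it into the
third slot, where the trace is a Ricci term. The other summands have rank one or are multiples of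
`φ` or the identity. -/
theorem trace_riemannEnd_comp_φ :
    LinearMap.trace ℝ _ (riemannEnd S.g x v w ∘ₗ (S.φ x).toLinearMap) =
      ricci S.g x v (S.φ x w) - (Module.finrank ℝ E - 2) * S.g.inner x (S.φ x v) w := by
  have e : (S.φ x).toLinearMap ∘ₗ riemannEnd S.g x v w = riemannEnd S.g x v (S.φ x w)
      + S.g.inner x v w • (S.φ x).toLinearMap
      - (S.g.inner x w).toLinearMap.smulRight (S.φ x v)
      + (S.g.inner x (S.φ x w)).toLinearMap.smulRight v
      - S.g.inner x (S.φ x v) w • LinearMap.id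
      - (2 * S.η x v) • (S.g.inner x (S.φ x w)).toLinearMap.smulRight (S.ξ x)
      + (2 * S.g.inner x (S.φ x v) w) • (S.η x).toLinearMap.smulRight (S.ξ x)
      - (2 * S.η x w * S.η x v) • (S.φ x).toLinearMap
      + (2 * S.η x w) • (S.η x).toLinearMap.smulRight (S.φ x v) := by
    ext u
    have h := riemann_φ hS (u := u) (v := v) (w := w)
    rw [S.inner_φ (u := u), S.g.symm x u w, S.g.symm x u (S.φ x w)] at h
    simp only [LinearMap.add_apply, LinearMap.sub_apply, LinearMap.smul_apply,
      LinearMap.smulRight_apply, LinearMap.id_apply, LinearMap.comp_apply, riemannEnd,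
      LinearMap.coe_mk, AddHom.coe_mk, ContinuousLinearMap.coe_coe, h]
    module
  rw [← Module.End.mul_eq_comp, LinearMap.trace_mul_comm, Module.End.mul_eq_comp, e]
  simp only [map_add, map_sub, map_smul, LinearMap.trace_smulRight, LinearMap.trace_id,
    S.trace_φ, ← ricci_eq_trace, ContinuousLinearMap.coe_coe, inner_ξ, S.η_φ, S.η_ξ]
  change _ + _ - _ + _ - S.g.inner x (S.φ x v) w • (Module.finrank ℝ E : ℝ) - _ + _ - _ + _ = _
  rw [S.g.symm x w, S.inner_φ (u := w), S.g.symm x w]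
  simp only [smul_eq_mul]
  ring

theorem nabla_curvature_ξ (hX : SmoothNear X x) (hY : SmoothNear Y x) (hZ : SmoothNear Z x) :
    nabla S.g X (curvature S.g Y S.ξ Z) x =
      (S.g.inner x (nabla S.g X Z x) (Y x) + S.g.inner x (Z x) (nabla S.g X Y x)) • S.ξ x
      + S.g.inner x (Z x) (Y x) • S.φ x (X x)
      - (S.η x (nabla S.g X Z x) + S.g.inner x (S.φ x (X x)) (Z x)) • Y x
      - S.η x (Z x) • nabla S.g X Y x := by
  have hg := hZ.inner S.g hY
  have hη := S.smoothFunNear_η hZ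
  have hξ := S.smoothNear_ξ (x := x)
  have e : ∀ᶠ y in 𝓝 x, curvature S.g Y S.ξ Z y =
      ((fun y => S.g.inner y (Z y) (Y y)) • S.ξ - (fun y => S.η y (Z y)) • Y) y := by
    filter_upwards [hY.eventually, hZ.eventually] with y h1 h2
    rw [curvature_eq_riemann h1 S.smoothNear_ξ h2, riemann_ξ_middle hS]
    rfl
  rw [nabla_congr_right ((SmoothNear.smul hg hξ).sub (SmoothNear.smul hη hY)) e,
    nabla_sub_right (SmoothNear.smul hg hξ) (SmoothNear.smul hη hY),
    nabla_smul_right hg.mdifferentiableAt hξ, nabla_smul_right hη.mdifferentiableAt hY,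
    nabla_metric hX hZ hY, nabla_ξ hS hX, mvfderiv_η hS hX hZ]
  module

/-- In the second Bianchi identity for `X`, `Y`, `ξ` the other two differentiated curvatures have
`ξ` among their first two arguments, so `nabla_curvature_ξ` makes them explicit. The bracket terms
supply the `φX` and `φY` inside `R`, through `∇ξ = φ`. -/
theorem nabla_ξ_curvature (hX : SmoothNear X x) (hY : SmoothNear Y x) (hZ : SmoothNear Z x) :
    nabla S.g S.ξ (curvature S.g X Y Z) x = riemann S.g x (nabla S.g S.ξ X x) (Y x) (Z x)
      - riemann S.g x (S.φ x (X x)) (Y x) (Z x)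
      + riemann S.g x (X x) (nabla S.g S.ξ Y x - S.φ x (Y x)) (Z x)
      + riemann S.g x (X x) (Y x) (nabla S.g S.ξ Z x)
      - S.g.inner x (Z x) (Y x) • S.φ x (X x) + S.g.inner x (S.φ x (Z x)) (X x) • Y x
      + S.g.inner x (Z x) (X x) • S.φ x (Y x) - S.g.inner x (Z x) (S.φ x (Y x)) • X x := by
  have hξ := S.smoothNear_ξ (x := x)
  have hb := curvature_second_bianchi (g := S.g) hX hY hξ hZ
  have e : curvature S.g S.ξ X Z = - curvature S.g X S.ξ Z := funext fun y => curvature_swap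
  rw [e, nabla_neg_right (hX.curvature hξ hZ), nabla_curvature_ξ hS hX hY hZ,
    nabla_curvature_ξ hS hY hX hZ,
    curvature_eq_riemann hY hξ (hX.nabla hZ), curvature_eq_riemann hξ hX (hY.nabla hZ),
    curvature_eq_riemann (hX.mlieBracket hY) hξ hZ,
    curvature_eq_riemann (hY.mlieBracket hξ) hX hZ,
    curvature_eq_riemann (hξ.mlieBracket hX) hY hZ,
    curvature_eq_riemann hX hY (hξ.nabla hZ),
    riemann_swap (u := S.ξ x), riemann_swap (u := mlieBracket I Y S.ξ x)] at hb
  simp only [riemann_ξ_middle hS] at hb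
  rw [← nabla_torsion_free (g := S.g) hX hY, ← nabla_torsion_free (g := S.g) hY hξ,
    ← nabla_torsion_free (g := S.g) hξ hX, nabla_ξ hS hX, nabla_ξ hS hY] at hb
  have e1 : riemann S.g x (X x) (S.φ x (Y x) - nabla S.g S.ξ Y x) (Z x) =
      - riemann S.g x (X x) (nabla S.g S.ξ Y x - S.φ x (Y x)) (Z x) := by
    rw [← neg_one_smul ℝ (riemann S.g x (X x) _ (Z x)), ← riemann_smul_middle, neg_one_smul,
      neg_sub]
  have e2 : riemann S.g x (nabla S.g S.ξ X x - S.φ x (X x)) (Y x) (Z x) =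
      riemann S.g x (nabla S.g S.ξ X x) (Y x) (Z x) - riemann S.g x (S.φ x (X x)) (Y x) (Z x) :=
    map_sub (riemannEnd S.g x (Y x) (Z x)) _ _
  have e3 : S.g.inner x (S.φ x (X x)) (Z x) = S.g.inner x (S.φ x (Z x)) (X x) := by
    rw [inner_φ, S.g.symm]
  have e4 : S.g.inner x (S.φ x (Y x)) (Z x) = S.g.inner x (Z x) (S.φ x (Y x)) := S.g.symm _ _ _
  rw [e1, e2, e3, e4] at hb
  simp only [map_sub] at hb
  linear_combination (norm := module) (1 : ℝ) • hb

/-- The covariant derivative of the Ricci tensor along the Reeb vector field. -/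
theorem mvfderiv_ricci_ξ (hY : SmoothNear Y x) (hZ : SmoothNear Z x) :
    d% (fun y => ricci S.g y (Y y) (Z y)) x (S.ξ x) =
      ricci S.g x (Y x) (nabla S.g S.ξ Z x) + ricci S.g x (nabla S.g S.ξ Y x - S.φ x (Y x)) (Z x)
        - ricci S.g x (Y x) (S.φ x (Z x)) := by
  have hξ := S.smoothNear_ξ (x := x)
  have hcurv {X : Π x : M, TangentSpace I x} (hX : SmoothNear X x) :
      ∀ᶠ y in 𝓝 x, riemannEnd S.g y (Y y) (Z y) (X y) = curvature S.g X Y Z y := by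
    filter_upwards [hX.eventually, hY.eventually, hZ.eventually] with y h1 h2 h3
    exact (curvature_eq_riemann h1 h2 h3).symm
  -- `B` sends `X` to `∇_ξ(R(X,Y)Z) - R(∇_ξ X, Y)Z`, as computed by `nabla_ξ_curvature`.
  let B : TangentSpace I x →ₗ[ℝ] TangentSpace I x :=
    riemannEnd S.g x (Y x) (nabla S.g S.ξ Z x)
      + riemannEnd S.g x (nabla S.g S.ξ Y x - S.φ x (Y x)) (Z x)
      - riemannEnd S.g x (Y x) (Z x) ∘ₗ (S.φ x).toLinearMap
      - S.g.inner x (Z x) (Y x) • (S.φ x).toLinearMap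
      + (S.g.inner x (S.φ x (Z x))).toLinearMap.smulRight (Y x)
      + (S.g.inner x (Z x)).toLinearMap.smulRight (S.φ x (Y x))
      - S.g.inner x (Z x) (S.φ x (Y x)) • LinearMap.id
  have h := mvfderiv_trace S.g (U := S.ξ) (fun y => riemannEnd S.g y (Y y) (Z y))
    (fun X hX => (hX.curvature hY hZ).congr (hcurv hX)) B (fun X hX => by
      rw [nabla_congr_right (hX.curvature hY hZ) (hcurv hX), nabla_ξ_curvature hS hX hY hZ]
      simp only [B, LinearMap.add_apply, LinearMap.sub_apply, LinearMap.smul_apply,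
        LinearMap.smulRight_apply, LinearMap.id_apply, LinearMap.comp_apply, riemannEnd,
        LinearMap.coe_mk, AddHom.coe_mk, ContinuousLinearMap.coe_coe]
      module)
  simp only [← ricci_eq_trace] at h
  rw [h]
  simp only [B, map_add, map_sub, map_smul, LinearMap.trace_smulRight, LinearMap.trace_id,
    S.trace_φ, ← ricci_eq_trace, ContinuousLinearMap.coe_coe, trace_riemannEnd_comp_φ hS]
  -- The multiples of `g(Z,φY)` add up to `(m-2) + 1 + 1 - m = 0`, with `m` the dimension, so only
  -- Ricci terms survive.
  change _ + _ - _ - _ + _ + _ - S.g.inner x (Z x) (S.φ x (Y x)) • (Module.finrank ℝ E : ℝ) = _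
  rw [S.inner_φ (u := Z x), S.g.symm x _ (Z x)]
  simp only [smul_eq_mul]
  ring

/-- Write `[kξ, A] = ∇_{kξ}A - ∇_A(kξ)`. Metric compatibility cancels the first kind of term, and
`∇_A(kξ) = kφA + dk(A)ξ`; the two `φ`-terms agree because `φ` is symmetric. -/
theorem lieDerivMetric_smul_ξ {k : M → ℝ} (hk : MDiffAt k x) :
    lieDerivMetric S.g (k • S.ξ) x u w =
      2 * k x * S.g.inner x u (S.φ x w) + d% k x u * S.η x w + d% k x w * S.η x u := by
  have hξ := S.smoothNear_ξ (x := x)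
  have hv : MDiffAt (T% (k • S.ξ)) x := hk.smul_section hξ.mdifferentiableAt
  have hu := smoothNear_extend u
  have hw := smoothNear_extend w
  have key {a : TangentSpace I x} : mlieBracket I (k • S.ξ) (extend E a) x =
      leviCivita S.g (extend E a) x ((k • S.ξ) x) - (k x • S.φ x a + d% k x a • S.ξ x) := by
    have ha := smoothNear_extend a
    rw [← leviCivita_torsion_free S.g hv ha.mdifferentiableAt]
    congr 1
    have h := nabla_smul_right (g := S.g) (X := extend E a) hk hξ
    rw [nabla_ξ hS ha, extend_apply_self] at h
    rw [← h]
    rfl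
  rw [lieDerivMetric, leviCivita_metric S.g hv hu.mdifferentiableAt hw.mdifferentiableAt, key, key,
    extend_apply_self, extend_apply_self]
  simp only [map_sub, map_add, map_smul, sub_apply, add_apply, smul_apply, smul_eq_mul, inner_ξ,
    ξ_inner, inner_φ]
  ring

/-! ### The soliton equation and the determination of `k`. -/

section Soliton

variable {k : M → ℝ} {lam mu nu : ℝ} (hk : MDiff k)
  (hsol : S.IsParaRicciLikeSoliton (k • S.ξ) lam mu nu)

include hk hsol

theorem ricci_of_soliton : ricci S.g x u w = -(k x + mu) * S.g.inner x u (S.φ x w)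
    - lam * S.g.inner x u w - (mu + nu) * (S.η x u * S.η x w)
    - (1 / 2) * (d% k x u * S.η x w + d% k x w * S.η x u) := by
  rw [hsol x u w, lieDerivMetric_smul_ξ hS (hk x), assocMetric]
  ring

theorem mvfderiv_ξ_of_soliton :
    d% k x (S.ξ x) = Module.finrank ℝ E - 1 - lam - mu - nu := by
  have h := ricci_ξ hS (v := S.ξ x)
  rw [ricci_of_soliton hS hk hsol, S.φ_ξ, map_zero, inner_ξ, S.η_ξ] at h
  linarith

/-- Compare the two expressions for `ρ(u,ξ)`, the value of `dk(ξ)` being already known. -/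
theorem mvfderiv_of_soliton :
    d% k x u = (Module.finrank ℝ E - 1 - lam - mu - nu) * S.η x u := by
  have h := ricci_ξ hS (v := u)
  rw [ricci_of_soliton hS hk hsol, S.φ_ξ, map_zero, inner_ξ, S.η_ξ,
    mvfderiv_ξ_of_soliton hS hk hsol] at h
  linarith

/-- With `dk` eliminated, `ρ` can be differentiated along `ξ` although `k` is only assumed
differentiable once. -/
theorem ricci_of_soliton' : ricci S.g x u w = -(k x + mu) * S.g.inner x u (S.φ x w)
    - lam * S.g.inner x u w + (lam + 1 - Module.finrank ℝ E) * (S.η x u * S.η x w) := by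
  rw [ricci_of_soliton hS hk hsol, mvfderiv_of_soliton hS hk hsol (u := u),
    mvfderiv_of_soliton hS hk hsol (u := w)]
  ring

theorem φ_relation_of_soliton :
    -(Module.finrank ℝ E - 1 - lam - mu - nu) * S.g.inner x u (S.φ x w)
      - 2 * (k x + mu) * (S.g.inner x u w - S.η x u * S.η x w)
      - 2 * lam * S.g.inner x u (S.φ x w) = 0 := by
  have hξ := S.smoothNear_ξ (x := x)
  have hu := smoothNear_extend u
  have hw := smoothNear_extend w
  have hφw := S.smoothNear_φ hw
  have h := mvfderiv_ricci_ξ hS hu hw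
  have h1 := (hu.inner S.g hφw).mdifferentiableAt
  have h2 := (hu.inner S.g hw).mdifferentiableAt
  have h3 := (S.smoothFunNear_η hu).mdifferentiableAt
  have h4 := (S.smoothFunNear_η hw).mdifferentiableAt
  have hα : MDiffAt (fun y => -(k y + mu)) x := ((hk x).add mdifferentiableAt_const).neg
  have hdα : d% (fun y => -(k y + mu)) x (S.ξ x) =
      -(Module.finrank ℝ E - 1 - lam - mu - nu) := by
    rw [mvfderiv_fun_neg, mvfderiv_fun_add (hk x) mdifferentiableAt_const, mvfderiv_const,
      add_zero, neg_apply, mvfderiv_ξ_of_soliton hS hk hsol]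
  -- Thus `∇_ξ φ = 0`, so `φ` is parallel along `ξ`.
  have hP : S.sasakiTensor x (S.ξ x) w = 0 := by
    rw [sasakiTensor, ξ_inner, S.η_ξ]
    module
  have hφ : nabla S.g S.ξ (fun y => S.φ y (extend E w y)) x =
      S.φ x (nabla S.g S.ξ (extend E w) x) := by
    rw [nabla_φ hS hw, extend_apply_self, hP, add_zero]
  simp only [ricci_of_soliton' hS hk hsol] at h
  rw [mvfderiv_combination hα h1 h2 h3 h4, hdα, nabla_metric hξ hu hφw, nabla_metric hξ hu hw,
    mvfderiv_η hS hξ hu, mvfderiv_η hS hξ hw] at h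
  simp only [hφ, extend_apply_self, S.φ_ξ, map_zero, zero_apply, map_sub, sub_apply, S.η_φ, S.φ_sq,
    map_smul, smul_eq_mul, inner_ξ, inner_φ] at h
  linear_combination h

theorem coeff_eq_of_soliton (hdim : Module.finrank ℝ E ≠ 1) : k x = -mu := by
  set c : ℝ := Module.finrank ℝ E - 1 - lam - mu - nu with hc
  -- The relation between bilinear forms becomes one between endomorphisms, so that its trace can be
  -- taken.
  have e : (-c - 2 * lam) • S.φ x - (2 * (k x + mu)) •
      (ContinuousLinearMap.id ℝ (TangentSpace I x) - (S.η x).smulRight (S.ξ x)) = 0 := by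
    refine leviCivitaFun_ext S.g fun u w => ?_
    have h := φ_relation_of_soliton hS hk hsol (x := x) (u := u) (w := w)
    simp only [sub_apply, smul_apply, ContinuousLinearMap.smulRight_apply,
      ContinuousLinearMap.id_apply, map_sub, map_smul, smul_eq_mul, zero_apply, map_zero,
      ξ_inner, inner_φ]
    linear_combination h
  have e' : (-c - 2 * lam) • (S.φ x).toLinearMap - (2 * (k x + mu)) •
      (LinearMap.id - (S.η x).toLinearMap.smulRight (S.ξ x)) = 0 :=
    LinearMap.ext fun u => DFunLike.congr_fun e u
  have h := congrArg (LinearMap.trace ℝ _) e'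
  rw [map_sub, map_smul, map_smul, map_sub, S.trace_φ, LinearMap.trace_id,
    LinearMap.trace_smulRight, map_zero] at h
  -- The trace of `I - η⊗ξ` is the dimension minus one, nonzero by `hdim`.
  change _ - (2 * (k x + mu)) * ((Module.finrank ℝ E : ℝ) - S.η x (S.ξ x)) = 0 at h
  rw [S.η_ξ, smul_zero, zero_sub, neg_eq_zero, mul_eq_zero, or_iff_left
    (sub_ne_zero.2 (by exact_mod_cast hdim))] at h
  linarith

end Soliton

end RiemannianPiStructure

end PiManifold

end

theorem mainTheorem1 (n : ℕ) (hn : 1 ≤ n)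
    {M : Type*} [TopologicalSpace M] [ChartedSpace (EuclideanSpace ℝ (Fin (2 * n + 1))) M]
    [IsManifold (𝓡 (2 * n + 1)) ∞ M]
    (S : PiManifold.RiemannianPiStructure (𝓡 (2 * n + 1)) M) (hS : S.IsParaSasakiLike)
    (k : M → ℝ) (hk : MDifferentiable (𝓡 (2 * n + 1)) 𝓘(ℝ, ℝ) k)
    (v : Π x : M, TangentSpace (𝓡 (2 * n + 1)) x) (hv : ∀ x, v x = k x • S.ξ x)
    (lam mu nu : ℝ) (hsol : S.IsParaRicciLikeSoliton v lam mu nu) :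
    (∀ x, k x = -mu) ∧
    (∀ x, lam + nu = k x + 2 * n) ∧
    S.IsEtaEinstein (-lam) 0 (lam - 2 * n) := by
  obtain rfl : v = k • S.ξ := funext hv
  have hdim : Module.finrank ℝ (EuclideanSpace ℝ (Fin (2 * n + 1))) = 2 * n + 1 := by simp
  -- Here `n ≥ 1` guarantees that the dimension is not 1.
  have hkmu (x : M) : k x = -mu := S.coeff_eq_of_soliton hS hk hsol (by omega)
  refine ⟨hkmu, fun x => ?_, rfl, fun x u w => ?_⟩
  · have h := S.mvfderiv_ξ_of_soliton hS hk hsol (x := x)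
    -- As `k` is constant, the formula for `dk(ξ)` reads `0 = 2n - λ - μ - ν`.
    rw [hdim, show k = fun _ => -mu from funext hkmu, mvfderiv_const] at h
    push_cast at h
    change (0 : ℝ) = _ at h
    rw [hkmu]
    linarith
  · rw [S.ricci_of_soliton' hS hk hsol, hdim, hkmu]
    push_cast
    ring
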